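/- Let $M, N \ge 1$ and $0 \le s \le M$ be integers. Let $\Lambda_s \subset (\mathbb{C}^{M\times N})^4$ be the linear subspace of four-tuples $(U,U',V,V')$ of complex $M\times N$ matrices such that the first $s$ rows of $U$ and $V$ are equal and the first $s$ rows of $U'$ and $V'$ are equal. Let $H_M$ be the complex vector space of pairs $(A,A')$ of complex $M\times M$ matrices with $A$ symmetric and $A'$ skew-symmetric. Write $u_n,u'_n,v_n,v'_n$ for the $n$-th columns of $U,U',V,V'$. Let $$\mathcal{B}_{M,N,s} \subset \mathbb{P}(\Lambda_s)\times\mathbb{P}(H_M\times H_M)$$ be the set of all points $([U,U',V,V'],[A,A',B,B'])$ such that 1. $A+iA' \ne B+iB'$; 2. $\operatorname{rank}(A+iA')=\operatorname{rank}(B+iB')=1$; 3. $u_n^T A u_n + {u'_n}^T A u'_n - 2u_n^T A' u'_n = v_n^T B v_n + {v'_n}^T B v'_n - 2 v_n^T B' v'_n$ for all $1\le n\le N$. Then the dimension of $\mathcal{B}_{M,N,s}$ (its Krull dimension in the topology induced by the Zariski topology of the product of projective spaces) is $$\dim \mathcal{B}_{M,N,s} = 4M+4MN-N-2sN-4.$$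 -/

import Mathlib

open scoped LinearAlgebra.Projectivization Matrix

noncomputable section

namespace FramePairs

/-- The Zariski topology on `ℙ V × ℙ W`, for finite-dimensional complex vector spaces `V` and `W`:
the open sets are the unions of the sets where some bihomogeneous polynomial function on `V × W`
does not vanish. Polynomial functions on `V × W` are written as polynomials in the linear
functionals on `V` (bidegree `(1, 0)`) and those on `W` (bidegree `(0, 1)`). The vanishing of a
bihomogeneous polynomial does not depend on the representatives chosen. -/
@[reducible] def zariskiTopology (V W : Type*) [AddCommGroup V] [Module ℂ V] [AddCommGroup W] [Module ℂ W] :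
    TopologicalSpace (ℙ ℂ V × ℙ ℂ W) :=
  TopologicalSpace.generateFrom
    {D | ∃ (f : MvPolynomial (Module.Dual ℂ V ⊕ Module.Dual ℂ W) ℂ) (d e : ℕ),
      f.IsWeightedHomogeneous
        (Sum.elim (fun _ => ((1, 0) : ℕ × ℕ)) (fun _ => ((0, 1) : ℕ × ℕ))) (d, e) ∧
      D = {p | MvPolynomial.eval
        (Sum.elim (fun l => l p.1.rep) (fun l => l p.2.rep)) f ≠ 0}}

/-- The dimension of a subset of `ℙ V × ℙ W`: the Krull dimension (supremum of the lengths of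
chains of irreducible closed subsets) for the topology induced by the Zariski topology. -/
def zariskiDim {V W : Type*} [AddCommGroup V] [Module ℂ V] [AddCommGroup W] [Module ℂ W]
    (X : Set (ℙ ℂ V × ℙ ℂ W)) : WithBot ℕ∞ :=
  letI : TopologicalSpace (ℙ ℂ V × ℙ ℂ W) := zariskiTopology V W
  topologicalKrullDim X

/-- Four-tuples `(U, U', V, V')` of complex `M × N` matrices. -/
abbrev Quad (M N : ℕ) : Type :=
  Matrix (Fin M) (Fin N) ℂ × Matrix (Fin M) (Fin N) ℂ ×
    Matrix (Fin M) (Fin N) ℂ × Matrix (Fin M) (Fin N) ℂ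

/-- The parameter space `Λ_s` of four-tuples `(U, U', V, V')` such that the first `s` rows of `U`
and `V` agree and the first `s` rows of `U'` and `V'` agree. -/
def Lam (M N s : ℕ) : Submodule ℂ (Quad M N) where
  carrier := {X | ∀ i : Fin M, (i : ℕ) < s → X.1 i = X.2.2.1 i ∧ X.2.1 i = X.2.2.2 i}
  add_mem' := fun hX hY i hi =>
    ⟨congrArg₂ (· + ·) (hX i hi).1 (hY i hi).1, congrArg₂ (· + ·) (hX i hi).2 (hY i hi).2⟩
  zero_mem' := fun _ _ => ⟨rfl, rfl⟩
  smul_mem' := fun c _ hX i hi =>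
    ⟨congrArg (c • ·) (hX i hi).1, congrArg (c • ·) (hX i hi).2⟩

/-- Pairs `(A, A')` of complex `M × M` matrices with `A` symmetric and `A'` skew-symmetric. -/
def SymSkew (M : ℕ) : Submodule ℂ (Matrix (Fin M) (Fin M) ℂ × Matrix (Fin M) (Fin M) ℂ) where
  carrier := {X | X.1ᵀ = X.1 ∧ X.2ᵀ = -X.2}
  add_mem' := fun {X Y} hX hY => ⟨by simp [hX.1, hY.1], by simp [hX.2, hY.2, add_comm]⟩
  zero_mem' := by simp
  smul_mem' := fun c X hX => ⟨by simp [hX.1], by simp [hX.2]⟩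

/-- The expression `uᵀ A u + u'ᵀ A u' - 2 uᵀ A' u'`. -/
def quadExpr {M : ℕ} (A A' : Matrix (Fin M) (Fin M) ℂ) (u u' : Fin M → ℂ) : ℂ :=
  u ⬝ᵥ A *ᵥ u + u' ⬝ᵥ A *ᵥ u' - 2 * (u ⬝ᵥ A' *ᵥ u')

/-- The incidence conditions on `(U, U', V, V')` and `((A, A'), (B, B'))`; the vector `u_n` is the
`n`-th column of `U`, and likewise for the other three matrices. -/
structure Incident {M N : ℕ} (X : Quad M N)
    (Y : (Matrix (Fin M) (Fin M) ℂ × Matrix (Fin M) (Fin M) ℂ) ×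
      (Matrix (Fin M) (Fin M) ℂ × Matrix (Fin M) (Fin M) ℂ)) : Prop where
  ne : Y.1.1 + Complex.I • Y.1.2 ≠ Y.2.1 + Complex.I • Y.2.2
  rank_left : (Y.1.1 + Complex.I • Y.1.2).rank = 1
  rank_right : (Y.2.1 + Complex.I • Y.2.2).rank = 1
  quad : ∀ n : Fin N,
    quadExpr Y.1.1 Y.1.2 (fun i => X.1 i n) (fun i => X.2.1 i n) =
      quadExpr Y.2.1 Y.2.2 (fun i => X.2.2.1 i n) (fun i => X.2.2.2 i n)

/-- The complex incidence variety `𝓑_{M,N,s}`. The conditions are invariant under rescaling either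
argument by a nonzero scalar, so they may be read on any representatives. -/
def incidenceVariety (M N s : ℕ) :
    Set (ℙ ℂ (Lam M N s) × ℙ ℂ (SymSkew M × SymSkew M)) :=
  {p | Incident (p.1.rep : Quad M N) ((p.2.rep.1 : _ × _), (p.2.rep.2 : _ × _))}

end FramePairs

end

/-! Put Q = A + iA', R = B + iB', and for each column w = u - iu', z = u + iu', with δ and ε the
differences between the corresponding combinations of v, v' and w, z. Pairs (A, A') correspond
linearly and bijectively to arbitrary matrices Q, and condition 3 becomes wᵀQz = (w+δ)ᵀR(z+ε), where
δ and ε vanish in the first s rows (`quadExpr_eq`, `incident_iff`). A rank one matrix has 2M - 1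
parameters, and a column has 2(2M - s) coordinates subject to one equation. This gives `numParams`
parameters for the bicone; the two scalings account for the difference from the claimed dimension.

Upper bound. A chain of irreducible closed sets gives a chain of prime ideals of their bicones. Each
strict inclusion yields one more algebraically independent function, starting from two
(`zariskiDim_le`). So it suffices to generate the function field of the bicone over any irreducible
subset by `numParams` elements: a rank one matrix is determined by the row and column through a
nonzero entry, and in every column some coordinate can be solved for
(`exists_redundant_coordinate`). No irreducible components have to be found.

Lower bound. Solving each equation for one entry of w gives a rational parametrization by
`numParams` parameters. Two of them are fixed as homogeneous references and the others are released
one at a time; the closures of the images grow strictly because every released parameter is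
recovered by a bihomogeneous equation (`le_zariskiDim`). -/

noncomputable section

namespace FramePairs

open MvPolynomial

/-! ### Bihomogeneous polynomials, the Zariski topology and vanishing ideals of bicones -/

section Zariski

variable {V W : Type*} [AddCommGroup V] [Module ℂ V] [AddCommGroup W] [Module ℂ W]

/-- Polynomial functions on `V × W`, as polynomials in the linear functionals. -/
abbrev BiPoly (V W : Type*) [AddCommGroup V] [Module ℂ V] [AddCommGroup W] [Module ℂ W] : Type _ :=
  MvPolynomial (Module.Dual ℂ V ⊕ Module.Dual ℂ W) ℂ

/-- The weights defining the bidegree. -/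
abbrev biweight (V W : Type*) [AddCommGroup V] [Module ℂ V] [AddCommGroup W] [Module ℂ W] :
    Module.Dual ℂ V ⊕ Module.Dual ℂ W → ℕ × ℕ :=
  Sum.elim (fun _ => ((1, 0) : ℕ × ℕ)) (fun _ => ((0, 1) : ℕ × ℕ))

/-- The value of a polynomial function at a pair of vectors. -/
def evalPair (v : V) (w : W) : BiPoly V W →ₐ[ℂ] ℂ :=
  aeval (Sum.elim (fun l => l v) (fun l => l w))

@[simp] lemma evalPair_inl (v : V) (w : W) (l : Module.Dual ℂ V) :
    evalPair v w (X (Sum.inl l)) = l v := by simp [evalPair]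

@[simp] lemma evalPair_inr (v : V) (w : W) (l : Module.Dual ℂ W) :
    evalPair v w (X (Sum.inr l)) = l w := by simp [evalPair]

lemma eval_eq_evalPair (v : V) (w : W) (f : BiPoly V W) :
    MvPolynomial.eval (Sum.elim (fun l => l v) (fun l => l w)) f = evalPair v w f := by
  rw [evalPair, ← coe_aeval_eq_eval]; rfl

/-- The restriction of a polynomial function to the plane of pairs `(a v, b w)`. -/
def restrictPlane (v : V) (w : W) : BiPoly V W →ₐ[ℂ] MvPolynomial (Fin 2) ℂ :=
  aeval (Sum.elim (fun l => C (l v) * X 0) (fun l => C (l w) * X 1))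

lemma eval_restrictPlane (v : V) (w : W) (c : Fin 2 → ℂ) (f : BiPoly V W) :
    MvPolynomial.eval c (restrictPlane v w f) = evalPair (c 0 • v) (c 1 • w) f := by
  induction f using MvPolynomial.induction_on with
  | C a => simp [restrictPlane, evalPair]
  | add p q hp hq => simp [hp, hq]
  | mul_X p i hp =>
    rw [map_mul, map_mul, map_mul, hp]
    congr 1
    rcases i with l | l <;> simp [restrictPlane, mul_comm]

lemma restrictPlane_of_isWeightedHomogeneous {f : BiPoly V W} {m : ℕ × ℕ}
    (hf : f.IsWeightedHomogeneous (biweight V W) m) (v : V) (w : W) :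
    restrictPlane v w f = C (evalPair v w f) * (X 0 ^ m.1 * X 1 ^ m.2) := by
  induction hf using IsWeightedHomogeneous.induction_on with
  | zero => simp
  | add a b _ _ ha hb => rw [map_add, ha, hb, map_add, C_add, add_mul]
  | monomial d r hd =>
    subst hd
    clear * -
    induction d using Finsupp.induction_linear generalizing r with
    | zero => simp [restrictPlane, evalPair, monomial_zero']
    | add d d' h h' =>
      have : (monomial (d + d') r : BiPoly V W) = monomial d r * monomial d' 1 := by
        rw [monomial_mul, mul_one]
      rw [this, map_mul, h, h', map_mul, map_add, C_mul, Prod.fst_add, Prod.snd_add, pow_add, pow_add]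
      ring
    | single i n =>
      rw [← C_mul_X_pow_eq_monomial]
      rcases i with l | l <;>
      simp [restrictPlane, evalPair, Finsupp.weight_single, mul_pow, mul_assoc, algHom_C]

lemma evalPair_smul_smul {f : BiPoly V W} {m : ℕ × ℕ}
    (hf : f.IsWeightedHomogeneous (biweight V W) m) (a b : ℂ) (v : V) (w : W) :
    evalPair (a • v) (b • w) f = a ^ m.1 * b ^ m.2 * evalPair v w f := by
  have := eval_restrictPlane v w ![a, b] f
  rw [restrictPlane_of_isWeightedHomogeneous hf] at this
  simp at this
  rw [← this]; ring

lemma exists_rep_eq (v : V) (hv : v ≠ 0) : ∃ a : ℂ, a ≠ 0 ∧ (Projectivization.mk ℂ v hv).rep = a • v := by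
  obtain ⟨a, ha⟩ := Projectivization.exists_smul_eq_mk_rep ℂ v hv
  exact ⟨a, a.ne_zero, ha.symm⟩

lemma evalPair_rep_ne_zero_iff {f : BiPoly V W} {m : ℕ × ℕ}
    (hf : f.IsWeightedHomogeneous (biweight V W) m) {v : V} {w : W} (hv : v ≠ 0) (hw : w ≠ 0) :
    evalPair (Projectivization.mk ℂ v hv).rep (Projectivization.mk ℂ w hw).rep f ≠ 0 ↔
      evalPair v w f ≠ 0 := by
  obtain ⟨a, ha, h1⟩ := exists_rep_eq v hv
  obtain ⟨b, hb, h2⟩ := exists_rep_eq w hw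
  rw [h1, h2, evalPair_smul_smul hf]
  simp [ha, hb]

attribute [local instance] zariskiTopology

lemma isOpen_ne_zero {f : BiPoly V W} {m : ℕ × ℕ}
    (hf : f.IsWeightedHomogeneous (biweight V W) m) :
    IsOpen {p : ℙ ℂ V × ℙ ℂ W | evalPair p.1.rep p.2.rep f ≠ 0} := by
  refine TopologicalSpace.isOpen_generateFrom_of_mem ⟨f, m.1, m.2, hf, ?_⟩
  simp only [eval_eq_evalPair]

/-- The nonvanishing loci of bihomogeneous polynomials form a basis of the Zariski topology. -/
lemma exists_bihomogeneous_of_mem_open {U : Set (ℙ ℂ V × ℙ ℂ W)} (hU : IsOpen U)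
    {p : ℙ ℂ V × ℙ ℂ W} (hp : p ∈ U) :
    ∃ (f : BiPoly V W) (m : ℕ × ℕ), f.IsWeightedHomogeneous (biweight V W) m ∧
      evalPair p.1.rep p.2.rep f ≠ 0 ∧
      ∀ q : ℙ ℂ V × ℙ ℂ W, evalPair q.1.rep q.2.rep f ≠ 0 → q ∈ U := by
  induction hU with
  | basic s hs =>
    obtain ⟨f, d, e, hf, rfl⟩ := hs
    simp only [eval_eq_evalPair, Set.mem_ofPred_eq] at hp ⊢
    exact ⟨f, (d, e), hf, hp, fun q hq => hq⟩
  | univ => exact ⟨1, 0, isWeightedHomogeneous_one _ _, by simp, fun _ _ => trivial⟩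
  | inter s t _ _ hs ht =>
    obtain ⟨f, m, hf, hfp, hfs⟩ := hs hp.1
    obtain ⟨g, n, hg, hgp, hgt⟩ := ht hp.2
    refine ⟨f * g, m + n, hf.mul hg, by simp [hfp, hgp], fun q hq => ?_⟩
    rw [map_mul] at hq
    exact ⟨hfs q (left_ne_zero_of_mul hq), hgt q (right_ne_zero_of_mul hq)⟩
  | sUnion S _ ih =>
    obtain ⟨s, hs, hps⟩ := hp
    obtain ⟨f, m, hf, hfp, hfs⟩ := ih s hs hps
    exact ⟨f, m, hf, hfp, fun q hq => ⟨s, hs, hfs q hq⟩⟩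

/-- The component of bidegree m restricts to a multiple of the monomial with exponents m, so
distinct components cannot cancel. This makes nonvanishing on the plane an open condition even for
polynomials that are not bihomogeneous. -/
lemma restrictPlane_ne_zero_iff (v : V) (w : W) (f : BiPoly V W) :
    restrictPlane v w f ≠ 0 ↔
      ∃ m, evalPair v w (weightedHomogeneousComponent (biweight V W) m f) ≠ 0 := by
  classical
  have key : ∀ m : ℕ × ℕ, restrictPlane v w (weightedHomogeneousComponent (biweight V W) m f) =
      monomial (Finsupp.equivFunOnFinite.symm ![m.1, m.2])
        (evalPair v w (weightedHomogeneousComponent (biweight V W) m f)) := by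
    intro m
    rw [restrictPlane_of_isWeightedHomogeneous
      (weightedHomogeneousComponent_isWeightedHomogeneous m f), monomial_eq]
    simp [Finsupp.prod_fintype]
  have hs := sum_weightedHomogeneousComponent (biweight V W) f
  rw [finsum_eq_sum _ (weightedHomogeneousComponent_finsupp f)] at hs
  have hsum := congrArg (restrictPlane v w) hs
  rw [map_sum] at hsum
  constructor
  · intro h
    rw [← hsum] at h
    obtain ⟨m, -, hm⟩ := Finset.exists_ne_zero_of_sum_ne_zero h
    refine ⟨m, fun h0 => hm ?_⟩
    rw [key, h0, monomial_zero]
  · rintro ⟨m, hm⟩ h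
    apply hm
    rw [h] at hsum
    have hc := congrArg (coeff (Finsupp.equivFunOnFinite.symm ![m.1, m.2])) hsum
    rw [coeff_sum, coeff_zero, Finset.sum_eq_single m] at hc
    · rwa [key, coeff_monomial, if_pos rfl] at hc
    · intro n _ hn
      rw [key, coeff_monomial, if_neg]
      intro he
      have he := Finsupp.equivFunOnFinite.symm.injective he
      exact hn (Prod.ext (congrFun he 0) (congrFun he 1))
    · intro hm'
      have h0 : weightedHomogeneousComponent (biweight V W) m f = 0 :=
        not_not.1 fun h0 => hm' ((Set.Finite.mem_toFinset _).2 h0)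
      rw [h0, map_zero, coeff_zero]

lemma isOpen_restrictPlane_ne_zero (f : BiPoly V W) :
    IsOpen {p : ℙ ℂ V × ℙ ℂ W | restrictPlane p.1.rep p.2.rep f ≠ 0} := by
  simp only [restrictPlane_ne_zero_iff, Set.ofPred_exists]
  exact isOpen_iUnion fun m =>
    isOpen_ne_zero (weightedHomogeneousComponent_isWeightedHomogeneous m f)

/-- The polynomials that vanish on the bicone over `Z`. -/
def vanishingIdeal (Z : Set (ℙ ℂ V × ℙ ℂ W)) : Ideal (BiPoly V W) where
  carrier := {f | ∀ p ∈ Z, restrictPlane p.1.rep p.2.rep f = 0}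
  add_mem' := fun hf hg p hp => by rw [map_add, hf p hp, hg p hp, add_zero]
  zero_mem' := fun p _ => map_zero _
  smul_mem' := fun c f hf p hp => by rw [smul_eq_mul, map_mul, hf p hp, mul_zero]

lemma mem_vanishingIdeal {Z : Set (ℙ ℂ V × ℙ ℂ W)} {f : BiPoly V W} :
    f ∈ vanishingIdeal Z ↔ ∀ p ∈ Z, restrictPlane p.1.rep p.2.rep f = 0 := Iff.rfl

lemma mem_vanishingIdeal_iff_of_isWeightedHomogeneous {Z : Set (ℙ ℂ V × ℙ ℂ W)} {f : BiPoly V W}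
    {m : ℕ × ℕ} (hf : f.IsWeightedHomogeneous (biweight V W) m) :
    f ∈ vanishingIdeal Z ↔ ∀ p ∈ Z, evalPair p.1.rep p.2.rep f = 0 := by
  rw [mem_vanishingIdeal]
  refine forall₂_congr fun p _ => ?_
  rw [restrictPlane_of_isWeightedHomogeneous hf]
  simp

/-- Two polynomials outside the ideal have nonvanishing loci that are open and meet Z, hence meet in
a common point of Z; there the restricted product is nonzero because polynomials in two variables
form a domain. -/
lemma vanishingIdeal_isPrime {Z : Set (ℙ ℂ V × ℙ ℂ W)} (hZ : IsIrreducible Z) :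
    (vanishingIdeal Z).IsPrime := by
  refine ⟨?_, ?_⟩
  · obtain ⟨p, hp⟩ := hZ.nonempty
    intro h
    have := mem_vanishingIdeal.1 ((Ideal.eq_top_iff_one _).1 h) p hp
    simp at this
  · intro f g hfg
    by_contra! h
    simp only [mem_vanishingIdeal, not_forall] at h
    obtain ⟨⟨p, hp, hfp⟩, ⟨q, hq, hgq⟩⟩ := h
    obtain ⟨r, hr, hfr, hgr⟩ := hZ.isPreirreducible _ _ (isOpen_restrictPlane_ne_zero f)
      (isOpen_restrictPlane_ne_zero g) ⟨p, hp, hfp⟩ ⟨q, hq, hgq⟩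
    have := hfg r hr
    rw [map_mul] at this
    exact mul_ne_zero hfr hgr this

end Zariski

/-! ### Chains of irreducible closed sets and algebraic independence -/

/-- An element of the kernel of a homomorphism from a domain is algebraically independent of any
family whose image is algebraically independent. -/
lemma algebraicIndependent_option_of_map_eq_zero {F A B ι : Type*} [Field F] [CommRing A]
    [IsDomain A] [Algebra F A] [CommRing B] [Algebra F B] (f : A →ₐ[F] B) {x : ι → A}
    (hx : AlgebraicIndependent F (f ∘ x)) {y : A} (hy : y ≠ 0) (hfy : f y = 0) :
    AlgebraicIndependent F (fun o : Option ι => o.elim y x) := by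
  have hx' : AlgebraicIndependent F x := hx.of_comp f
  rw [hx'.option_iff_transcendental]
  intro halg
  -- An algebraic relation for y can be divided by powers of y until its constant coefficient is
  -- nonzero. Applying f then kills every term except the constant one.
  obtain ⟨p, hp0, hp⟩ := halg.exists_nonzero_coeff_and_aeval_eq_zero
    (mem_nonZeroDivisors_of_ne_zero hy)
  obtain ⟨P, hP⟩ : ∃ P : MvPolynomial ι F, aeval x P = (p.coeff 0 : A) := by
    have := (p.coeff 0).2
    exact (Algebra.adjoin_range_eq_range_aeval F x).le this
  have h1 : f (p.coeff 0 : A) = 0 := by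
    rw [← Polynomial.divX_mul_X_add p] at hp
    have := congrArg f hp
    simpa [hfy] using this
  rw [← hP, comp_aeval_apply] at h1
  have hP0 : P = 0 := hx.eq_zero_of_aeval_eq_zero P h1
  apply hp0
  rw [hP0, map_zero] at hP
  exact Subtype.ext hP.symm

section Zariski

variable {V W : Type*} [AddCommGroup V] [Module ℂ V] [AddCommGroup W] [Module ℂ W]

attribute [local instance] zariskiTopology

lemma exists_dual_eq_one {v : V} (hv : v ≠ 0) : ∃ l : Module.Dual ℂ V, l v = 1 := by
  by_contra! h
  refine hv ((Module.forall_dual_apply_eq_zero_iff ℂ v).1 fun l => ?_)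
  by_contra hl
  exact h ((l v)⁻¹ • l) (by simp [hl])

/-- The two scaling directions of the bicone: functionals normalized to 1 at a point of Z restrict
to the coordinates of the plane over that point. -/
lemma exists_algebraicIndependent_two {Z : Set (ℙ ℂ V × ℙ ℂ W)} (hZ : Z.Nonempty) :
    ∃ x : Fin 2 → BiPoly V W ⧸ vanishingIdeal Z, AlgebraicIndependent ℂ x := by
  obtain ⟨p, hp⟩ := hZ
  obtain ⟨l, hl⟩ := exists_dual_eq_one p.1.rep_nonzero
  obtain ⟨m, hm⟩ := exists_dual_eq_one p.2.rep_nonzero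
  refine ⟨Ideal.Quotient.mkₐ ℂ _ ∘ ![X (Sum.inl l), X (Sum.inr m)], ?_⟩
  rw [algebraicIndependent_iff]
  intro P hP
  have h1 : Ideal.Quotient.mkₐ ℂ (vanishingIdeal Z)
      (aeval ![X (Sum.inl l), X (Sum.inr m)] P) = 0 := by
    rw [← hP, comp_aeval_apply]; rfl
  have h2 := mem_vanishingIdeal.1 (Ideal.Quotient.eq_zero_iff_mem.1 h1) p hp
  rw [comp_aeval_apply] at h2
  have h3 : (restrictPlane p.1.rep p.2.rep) ∘ ![X (Sum.inl l), X (Sum.inr m)] = X := by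
    funext i
    fin_cases i <;> simp [restrictPlane, hl, hm]
  change aeval ((restrictPlane p.1.rep p.2.rep) ∘ ![X (Sum.inl l), X (Sum.inr m)]) P = 0 at h2
  rw [h3] at h2
  simpa using h2

/-- Lift the given family to the quotient by I and adjoin an element of J outside I, which is
nonzero there and maps to zero modulo J. -/
lemma exists_algebraicIndependent_succ {A : Type*} [CommRing A] [Algebra ℂ A] {I J : Ideal A}
    [I.IsPrime] (hIJ : I < J) {n : ℕ}
    (hJ : ∃ x : Fin n → A ⧸ J, AlgebraicIndependent ℂ x) :
    ∃ x : Fin (n + 1) → A ⧸ I, AlgebraicIndependent ℂ x := by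
  obtain ⟨x, hx⟩ := hJ
  obtain ⟨y, hyJ, hyI⟩ := SetLike.exists_of_lt hIJ
  choose x' hx' using fun i => Ideal.Quotient.factor_surjective hIJ.le (x i)
  have hcomp : (Ideal.Quotient.factorₐ ℂ hIJ.le) ∘ x' = x := funext hx'
  have := algebraicIndependent_option_of_map_eq_zero (Ideal.Quotient.factorₐ ℂ hIJ.le)
    (x := x') (by rwa [hcomp]) (y := Ideal.Quotient.mk I y)
    (by rwa [Ne, Ideal.Quotient.eq_zero_iff_mem])
    (by simpa [Ideal.Quotient.eq_zero_iff_mem] using hyJ)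
  exact ⟨_, (algebraicIndependent_equiv (finSuccEquiv n)).2 this⟩

/-- Strictness holds because a point of Z' outside the closed set Z is separated from Z by a single
bihomogeneous polynomial, as these define a basis of the topology. -/
lemma vanishingIdeal_image_lt {X : Set (ℙ ℂ V × ℙ ℂ W)}
    {Z Z' : TopologicalSpace.IrreducibleCloseds X} (h : Z < Z') :
    vanishingIdeal (Subtype.val '' (Z' : Set X)) < vanishingIdeal (Subtype.val '' (Z : Set X)) := by
  have hsub : (Z : Set X) ⊆ Z' := h.le
  refine lt_of_le_of_ne (fun f hf p hp => hf p (Set.image_mono hsub hp)) fun heq => ?_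
  obtain ⟨q, hq', hq⟩ := SetLike.exists_of_lt h
  obtain ⟨U, hU, hUZ⟩ := isOpen_induced_iff.1 Z.isClosed.isOpen_compl
  have hqU : q.1 ∈ U := by
    change q ∈ Subtype.val ⁻¹' U
    rw [hUZ]; exact hq
  obtain ⟨f, m, hf, hfq, hfU⟩ := exists_bihomogeneous_of_mem_open hU hqU
  have hfZ : f ∈ vanishingIdeal (Subtype.val '' (Z : Set X)) := by
    rw [mem_vanishingIdeal_iff_of_isWeightedHomogeneous hf]
    rintro _ ⟨r, hr, rfl⟩
    by_contra hne
    have : r ∈ Subtype.val ⁻¹' U := hfU _ hne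
    rw [hUZ] at this
    exact this hr
  rw [← heq, mem_vanishingIdeal_iff_of_isWeightedHomogeneous hf] at hfZ
  exact hfq (hfZ _ ⟨q, hq', rfl⟩)

/-- If the coordinate ring of the bicone over any irreducible subset of `X` has at most `D + 2`
algebraically independent elements, then `X` has dimension at most `D`. -/
theorem zariskiDim_le {X : Set (ℙ ℂ V × ℙ ℂ W)} {D : ℕ}
    (h : ∀ Z ⊆ X, IsIrreducible Z → ∀ (n : ℕ) (x : Fin n → BiPoly V W ⧸ vanishingIdeal Z),
      AlgebraicIndependent ℂ x → n ≤ D + 2) :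
    zariskiDim X ≤ (D : WithBot ℕ∞) := by
  change Order.krullDim (TopologicalSpace.IrreducibleCloseds X) ≤ _
  refine iSup_le fun p => ?_
  have hirr : ∀ i, IsIrreducible (Subtype.val '' (p i : Set X)) := fun i =>
    (p i).isIrreducible.image _ continuous_subtype_val.continuousOn
  -- The offset 2 is the contribution of the two scalings, already present for the smallest member
  -- of the chain.
  have key : ∀ k (hk : k < p.length + 1), ∃ x : Fin (k + 2) →
      BiPoly V W ⧸ vanishingIdeal (Subtype.val '' (p ⟨k, hk⟩ : Set X)),
      AlgebraicIndependent ℂ x := by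
    intro k
    induction k with
    | zero => exact fun hk => exists_algebraicIndependent_two (hirr _).nonempty
    | succ k ih =>
      intro hk
      have := vanishingIdeal_isPrime (hirr ⟨k + 1, hk⟩)
      have hlt : p ⟨k, by omega⟩ < p ⟨k + 1, hk⟩ := p.step ⟨k, by omega⟩
      exact exists_algebraicIndependent_succ (vanishingIdeal_image_lt hlt) (ih (by omega))
  obtain ⟨x, hx⟩ := key p.length (by omega)
  have := h _ (Subtype.coe_image_subset _ _) (hirr _) _ x hx
  exact_mod_cast (by omega : p.length ≤ D)

/-! ### Dimension bounds from rational parametrizations -/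

section Parametrization

variable {ι : Type*}

/-- The functions on affine space that are quotients of polynomials by powers of `h`, where `h`
does not vanish. -/
def regularFunctions (h : MvPolynomial ι ℂ) : Subalgebra ℂ ((ι → ℂ) → ℂ) where
  carrier := {f | ∃ (k : ℕ) (P : MvPolynomial ι ℂ),
    ∀ x, MvPolynomial.eval x h ≠ 0 → MvPolynomial.eval x h ^ k * f x = MvPolynomial.eval x P}
  mul_mem' := by
    rintro f g ⟨k, P, hP⟩ ⟨l, Q, hQ⟩
    refine ⟨k + l, P * Q, fun x hx => ?_⟩
    rw [map_mul, ← hP x hx, ← hQ x hx, pow_add, Pi.mul_apply]; ring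
  add_mem' := by
    rintro f g ⟨k, P, hP⟩ ⟨l, Q, hQ⟩
    refine ⟨k + l, h ^ l * P + h ^ k * Q, fun x hx => ?_⟩
    simp only [map_add, map_mul, map_pow, ← hP x hx, ← hQ x hx, pow_add, Pi.add_apply]; ring
  algebraMap_mem' r := ⟨0, C r, fun x _ => by simp⟩

lemma eval_mem_regularFunctions (h P : MvPolynomial ι ℂ) :
    (fun x => MvPolynomial.eval x P) ∈ regularFunctions h := ⟨0, P, fun x _ => by simp⟩

lemma inv_mem_regularFunctions {h P : MvPolynomial ι ℂ} (hP : P ∣ h) :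
    (fun x => (MvPolynomial.eval x P)⁻¹) ∈ regularFunctions h := by
  obtain ⟨Q, rfl⟩ := hP
  refine ⟨1, Q, fun x hx => ?_⟩
  rw [map_mul] at hx ⊢
  have := left_ne_zero_of_mul hx
  field_simp

variable {h : MvPolynomial ι ℂ} {φ : (ι → ℂ) → V} {ψ : (ι → ℂ) → W}

lemma evalPair_mem_regularFunctions
    (hφ : ∀ l : Module.Dual ℂ V, (fun x => l (φ x)) ∈ regularFunctions h)
    (hψ : ∀ l : Module.Dual ℂ W, (fun x => l (ψ x)) ∈ regularFunctions h) (f : BiPoly V W) :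
    (fun x => evalPair (φ x) (ψ x) f) ∈ regularFunctions h := by
  induction f using MvPolynomial.induction_on with
  | C a =>
    simp only [algHom_C]
    exact (regularFunctions h).algebraMap_mem a
  | add p q hp hq => simp only [map_add]; exact add_mem hp hq
  | mul_X p i hp =>
    simp only [map_mul]
    refine mul_mem hp ?_
    rcases i with l | l
    · simpa only [evalPair_inl] using hφ l
    · simpa only [evalPair_inr] using hψ l

/-- Restriction of polynomials to the coordinate subspace through `p` in the directions `T`. -/
def restrictSlice (p : ι → ℂ) (T : Set ι) : MvPolynomial ι ℂ →ₐ[ℂ] MvPolynomial ι ℂ :=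
  open Classical in aeval fun i => if i ∈ T then X i else C (p i)

lemma eval_restrictSlice (p : ι → ℂ) (T : Set ι) [DecidablePred (· ∈ T)] (x : ι → ℂ)
    (P : MvPolynomial ι ℂ) : MvPolynomial.eval x (restrictSlice p T P) =
      MvPolynomial.eval (fun i => if i ∈ T then x i else p i) P := by
  induction P using MvPolynomial.induction_on with
  | C a => simp [restrictSlice]
  | add p q hp hq => simp [hp, hq]
  | mul_X p i hp =>
    rw [map_mul, map_mul, map_mul, hp]
    congr 1
    by_cases hi : i ∈ T <;> simp [restrictSlice, hi]

/-- Over the infinite field ℂ a nonzero polynomial has a point of nonvanishing. Combined with the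
absence of zero divisors, this yields points of a slice at which several polynomials are nonzero
simultaneously. -/
lemma restrictSlice_ne_zero_iff {p : ι → ℂ} {T : Set ι} {P : MvPolynomial ι ℂ} :
    restrictSlice p T P ≠ 0 ↔ ∃ x, (∀ i ∉ T, x i = p i) ∧ MvPolynomial.eval x P ≠ 0 := by
  classical
  constructor
  · intro h
    by_contra! h'
    refine h (MvPolynomial.funext fun x => ?_)
    rw [eval_restrictSlice, map_zero]
    exact h' _ fun i hi => if_neg hi
  · rintro ⟨x, hx, hP⟩ h
    apply hP
    have := eval_restrictSlice p T x P
    rw [h, map_zero] at this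
    rw [this]
    congr 2
    funext i
    by_cases hi : i ∈ T
    · simp [hi]
    · simp [hi, hx i hi]

/-- The points of `X` parametrized by the coordinate subspace through `p` in the directions `T`. -/
def sliceImage (X : Set (ℙ ℂ V × ℙ ℂ W)) (h : MvPolynomial ι ℂ) (φ : (ι → ℂ) → V)
    (ψ : (ι → ℂ) → W) (p : ι → ℂ) (T : Set ι) : Set X :=
  {q | ∃ x, (∀ i ∉ T, x i = p i) ∧ MvPolynomial.eval x h ≠ 0 ∧
    ∃ (hv : φ x ≠ 0) (hw : ψ x ≠ 0), q.1 = (Projectivization.mk ℂ _ hv, Projectivization.mk ℂ _ hw)}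

lemma evalPair_rep_of_eq_mk {f : BiPoly V W} {m : ℕ × ℕ}
    (hf : f.IsWeightedHomogeneous (biweight V W) m) {v : V} {w : W} (hv : v ≠ 0) (hw : w ≠ 0)
    {q : ℙ ℂ V × ℙ ℂ W} (hq : q = (Projectivization.mk ℂ v hv, Projectivization.mk ℂ w hw)) :
    evalPair q.1.rep q.2.rep f ≠ 0 ↔ evalPair v w f ≠ 0 := by
  subst hq
  exact evalPair_rep_ne_zero_iff hf hv hw

/-- A nonempty open subset of an affine space is irreducible and the parametrization is rational
with denominators powers of h: each open set meeting the image pulls back to contain the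
nonvanishing locus of a polynomial that is nonzero on the slice, up to the condition h ≠ 0. -/
lemma sliceImage_isIrreducible {X : Set (ℙ ℂ V × ℙ ℂ W)}
    (hφ : ∀ l : Module.Dual ℂ V, (fun x => l (φ x)) ∈ regularFunctions h)
    (hψ : ∀ l : Module.Dual ℂ W, (fun x => l (ψ x)) ∈ regularFunctions h)
    (hX : ∀ x, MvPolynomial.eval x h ≠ 0 → ∃ (hv : φ x ≠ 0) (hw : ψ x ≠ 0),
      (Projectivization.mk ℂ _ hv, Projectivization.mk ℂ _ hw) ∈ X)
    {p : ι → ℂ} (hp : MvPolynomial.eval p h ≠ 0) (T : Set ι) :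
    IsIrreducible (sliceImage X h φ ψ p T) := by
  constructor
  · obtain ⟨hv, hw, hmem⟩ := hX p hp
    exact ⟨⟨_, hmem⟩, p, fun _ _ => rfl, hp, hv, hw, rfl⟩
  · have key : ∀ U : Set X, IsOpen U → (sliceImage X h φ ψ p T ∩ U).Nonempty →
        ∃ P : MvPolynomial ι ℂ, restrictSlice p T P ≠ 0 ∧
          ∀ x, MvPolynomial.eval x h ≠ 0 → MvPolynomial.eval x P ≠ 0 →
            ∀ (hv : φ x ≠ 0) (hw : ψ x ≠ 0) (q : X),
              q.1 = (Projectivization.mk ℂ _ hv, Projectivization.mk ℂ _ hw) → q ∈ U := by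
      rintro U hU ⟨q, ⟨x, hxT, hxh, hv, hw, hq⟩, hqU⟩
      obtain ⟨U', hU', rfl⟩ := isOpen_induced_iff.1 hU
      obtain ⟨f, m, hf, hfq, hfU⟩ := exists_bihomogeneous_of_mem_open hU' hqU
      obtain ⟨k, P, hP⟩ := evalPair_mem_regularFunctions hφ hψ f
      refine ⟨P, restrictSlice_ne_zero_iff.2 ⟨x, hxT, ?_⟩, ?_⟩
      · rw [← hP x hxh]
        exact mul_ne_zero (pow_ne_zero _ hxh) ((evalPair_rep_of_eq_mk hf hv hw hq).1 hfq)
      · intro y hyh hyP hv hw r hr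
        refine hfU _ ((evalPair_rep_of_eq_mk hf hv hw hr).2 ?_)
        rw [← hP y hyh] at hyP
        exact right_ne_zero_of_mul hyP
    intro U U' hU hU' hne hne'
    obtain ⟨P, hP0, hP⟩ := key U hU hne
    obtain ⟨Q, hQ0, hQ⟩ := key U' hU' hne'
    have hh : restrictSlice p T h ≠ 0 := restrictSlice_ne_zero_iff.2 ⟨p, fun _ _ => rfl, hp⟩
    have := mul_ne_zero (mul_ne_zero hP0 hQ0) hh
    rw [← map_mul, ← map_mul, restrictSlice_ne_zero_iff] at this
    obtain ⟨x, hxT, hx⟩ := this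
    rw [map_mul, map_mul] at hx
    have hxh := right_ne_zero_of_mul hx
    have hxP := left_ne_zero_of_mul (left_ne_zero_of_mul hx)
    have hxQ := right_ne_zero_of_mul (left_ne_zero_of_mul hx)
    obtain ⟨hv, hw, hmem⟩ := hX x hxh
    exact ⟨⟨_, hmem⟩, ⟨x, hxT, hxh, hv, hw, rfl⟩, hP x hxh hxP hv hw _ rfl,
      hQ x hxh hxQ hv hw _ rfl⟩

/-- A set that contains a rationally parametrized family in which `d` of the parameters can be
recovered by bihomogeneous equations has dimension at least `d`. -/
theorem le_zariskiDim {X : Set (ℙ ℂ V × ℙ ℂ W)}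
    (hφ : ∀ l : Module.Dual ℂ V, (fun x => l (φ x)) ∈ regularFunctions h)
    (hψ : ∀ l : Module.Dual ℂ W, (fun x => l (ψ x)) ∈ regularFunctions h)
    (hX : ∀ x, MvPolynomial.eval x h ≠ 0 → ∃ (hv : φ x ≠ 0) (hw : ψ x ≠ 0),
      (Projectivization.mk ℂ _ hv, Projectivization.mk ℂ _ hw) ∈ X)
    {p : ι → ℂ} (hp : MvPolynomial.eval p h ≠ 0) {d : ℕ} (e : Fin d ↪ ι)
    {G : Fin d → BiPoly V W} {m : Fin d → ℕ × ℕ}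
    (hG : ∀ i, (G i).IsWeightedHomogeneous (biweight V W) (m i))
    (hGx : ∀ i x, MvPolynomial.eval x h ≠ 0 →
      (∀ j, j ∉ Set.range e → x j = p j) →
      (evalPair (φ x) (ψ x) (G i) = 0 ↔ x (e i) = p (e i))) :
    (d : WithBot ℕ∞) ≤ zariskiDim X := by
  change _ ≤ Order.krullDim (TopologicalSpace.IrreducibleCloseds X)
  rw [Order.le_krullDim_iff]
  -- The first k selected parameters vary and all others keep their value at p; the closures of
  -- these slice images form the chain.
  let T : ℕ → Set ι := fun k => {i | ∃ j : Fin d, (j : ℕ) < k ∧ e j = i}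
  have hTe : ∀ k j, j ∉ Set.range e → j ∉ T k := by
    rintro k j hj ⟨i, -, rfl⟩
    exact hj ⟨i, rfl⟩
  let C : Fin (d + 1) → TopologicalSpace.IrreducibleCloseds X := fun k =>
    ⟨closure (sliceImage X h φ ψ p (T k)),
      (sliceImage_isIrreducible hφ hψ hX hp _).closure, isClosed_closure⟩
  refine ⟨⟨d, C, fun k => ?_⟩, rfl⟩
  have hsub : sliceImage X h φ ψ p (T k) ⊆ sliceImage X h φ ψ p (T (k + 1)) := by
    rintro q ⟨x, hx, hq⟩
    refine ⟨x, fun i hi => hx i fun ⟨j, hj, hji⟩ => hi ⟨j, by omega, hji⟩, hq⟩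
  change C k.castSucc < C k.succ
  refine SetLike.lt_iff_le_and_exists.2 ⟨?_, ?_⟩
  · change closure (sliceImage X h φ ψ p (T k)) ⊆ closure (sliceImage X h φ ψ p (T (k + 1)))
    exact closure_mono hsub
  -- Release the parameter e k and choose a point where it differs from its value at p. The form G k
  -- vanishes on the smaller slice image, hence on its closure, but not at this point.
  · have h1 : restrictSlice p (T (k + 1)) h ≠ 0 :=
      restrictSlice_ne_zero_iff.2 ⟨p, fun _ _ => rfl, hp⟩
    have h2 : restrictSlice p (T (k + 1)) (MvPolynomial.X (e k) - MvPolynomial.C (p (e k))) ≠ 0 := by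
      classical
      refine restrictSlice_ne_zero_iff.2 ⟨Function.update p (e k) (p (e k) + 1), ?_, by simp⟩
      intro i hi
      refine Function.update_of_ne (fun hik => hi ⟨k, by omega, hik.symm⟩) _ _
    have := mul_ne_zero h1 h2
    rw [← map_mul, restrictSlice_ne_zero_iff] at this
    obtain ⟨x, hxT, hx⟩ := this
    rw [map_mul] at hx
    have hxh := left_ne_zero_of_mul hx
    have hxk : x (e k) ≠ p (e k) := by
      have := right_ne_zero_of_mul hx
      simpa [sub_eq_zero] using this
    obtain ⟨hv, hw, hmem⟩ := hX x hxh
    refine ⟨⟨_, hmem⟩, subset_closure ⟨x, hxT, hxh, hv, hw, rfl⟩, fun hcl => ?_⟩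
    have hopen : IsOpen (Subtype.val ⁻¹' {q : ℙ ℂ V × ℙ ℂ W | evalPair q.1.rep q.2.rep (G k) ≠ 0} :
      Set X) := (isOpen_ne_zero (hG k)).preimage continuous_subtype_val
    have hx0 := (hGx k x hxh fun j hj => hxT j (hTe _ j hj)).not.2 hxk
    obtain ⟨q, hqG, y, hyT, hyh, hv', hw', hq⟩ := mem_closure_iff.1 hcl _ hopen
      ((evalPair_rep_of_eq_mk (hG k) hv hw rfl).2 hx0)
    refine (evalPair_rep_of_eq_mk (hG k) hv' hw' hq).1 hqG
      ((hGx k y hyh fun j hj => hyT j (hTe _ j hj)).2 (hyT _ ?_))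
    rintro ⟨j, hj, hjk⟩
    have hjk := congrArg Fin.val (e.injective hjk)
    change (j : ℕ) < (k : ℕ) at hj
    omega

end Parametrization

end Zariski

/-! ### Rank one matrices and the bilinear form of the equations -/

lemma rank_eq_one_iff {m n : Type*} [Fintype m] [Fintype n] (Q : Matrix m n ℂ) :
    Q.rank = 1 ↔ Q ≠ 0 ∧ ∃ (a : m → ℂ) (b : n → ℂ), Q = Matrix.vecMulVec a b := by
  classical
  constructor
  · intro h
    refine ⟨fun h0 => by simp [h0] at h, ?_⟩
    obtain ⟨v, -, hv⟩ := finrank_eq_one_iff'.1 h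
    -- The j-th column is the image of the j-th basis vector, hence a multiple b j of the vector
    -- spanning the range.
    choose b hb using fun j => hv ⟨Q.mulVecLin (Pi.single j 1), LinearMap.mem_range_self _ _⟩
    refine ⟨v, b, ?_⟩
    ext i j
    have := congrFun (congrArg Subtype.val (hb j)) i
    simp [Matrix.mulVec_single] at this
    rw [Matrix.vecMulVec_apply, mul_comm, this]
  · rintro ⟨h0, a, b, rfl⟩
    have h1 := Matrix.rank_vecMulVec_le a b
    have h2 : (Matrix.vecMulVec a b).rank ≠ 0 := by
      intro h
      rw [Matrix.rank, Submodule.finrank_eq_zero, LinearMap.range_eq_bot, ← Matrix.toLin'_apply',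
        LinearEquiv.map_eq_zero_iff] at h
      exact h0 h
    omega

/-- In the expanded product the mixed terms in A cancel by symmetry and the diagonal terms in A'
vanish by skew-symmetry. The quadratic expression thus becomes bilinear in two independent vectors,
so it can be solved linearly for either. -/
lemma quadExpr_eq {M : ℕ} {A A' : Matrix (Fin M) (Fin M) ℂ} (hA : Aᵀ = A) (hA' : A'ᵀ = -A')
    (u u' : Fin M → ℂ) :
    quadExpr A A' u u' =
      (u - Complex.I • u') ⬝ᵥ (A + Complex.I • A') *ᵥ (u + Complex.I • u') := by
  have hsym : u' ⬝ᵥ A *ᵥ u = u ⬝ᵥ A *ᵥ u' := by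
    rw [Matrix.dotProduct_mulVec, ← Matrix.mulVec_transpose, hA, dotProduct_comm]
  have hskew : ∀ a b : Fin M → ℂ, a ⬝ᵥ A' *ᵥ b = -(b ⬝ᵥ A' *ᵥ a) := fun a b => by
    rw [Matrix.dotProduct_mulVec, ← Matrix.mulVec_transpose, hA', dotProduct_comm, Matrix.neg_mulVec,
      dotProduct_neg]
  have h1 : u ⬝ᵥ A' *ᵥ u = 0 := self_eq_neg.1 (hskew u u)
  have h2 : u' ⬝ᵥ A' *ᵥ u' = 0 := self_eq_neg.1 (hskew u' u')
  simp only [quadExpr, Matrix.add_mulVec, Matrix.mulVec_add, Matrix.smul_mulVec, Matrix.mulVec_smul,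
    sub_dotProduct, dotProduct_add, smul_dotProduct, dotProduct_smul, smul_eq_mul, hsym, h1, h2,
    hskew u' u]
  linear_combination (u' ⬝ᵥ A *ᵥ u' - 2 * u ⬝ᵥ A' *ᵥ u') * Complex.I_sq

/-! ### Linear coordinates on the two vector spaces -/

section Coordinates

variable {M N s : ℕ}

/-- The functional `z_{k,n} = u_{k,n} + i u'_{k,n}`. -/
def zForm (n : Fin N) (k : Fin M) : Module.Dual ℂ (Lam M N s) where
  toFun X := X.1.1 k n + Complex.I * X.1.2.1 k n
  map_add' X Y := by simp; ring
  map_smul' c X := by simp; ring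

/-- The functional `w_{k,n} = u_{k,n} - i u'_{k,n}`. -/
def wForm (n : Fin N) (k : Fin M) : Module.Dual ℂ (Lam M N s) where
  toFun X := X.1.1 k n - Complex.I * X.1.2.1 k n
  map_add' X Y := by simp; ring
  map_smul' c X := by simp; ring

/-- The functional `(v_{k,n} + i v'_{k,n}) - (u_{k,n} + i u'_{k,n})`. -/
def zDiffForm (n : Fin N) (k : Fin M) : Module.Dual ℂ (Lam M N s) where
  toFun X := (X.1.2.2.1 k n + Complex.I * X.1.2.2.2 k n) - (X.1.1 k n + Complex.I * X.1.2.1 k n)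
  map_add' X Y := by simp; ring
  map_smul' c X := by simp; ring

/-- The functional `(v_{k,n} - i v'_{k,n}) - (u_{k,n} - i u'_{k,n})`. -/
def wDiffForm (n : Fin N) (k : Fin M) : Module.Dual ℂ (Lam M N s) where
  toFun X := (X.1.2.2.1 k n - Complex.I * X.1.2.2.2 k n) - (X.1.1 k n - Complex.I * X.1.2.1 k n)
  map_add' X Y := by simp; ring
  map_smul' c X := by simp; ring

lemma zDiffForm_eq_zero (n : Fin N) {k : Fin M} (hk : (k : ℕ) < s) :
    zDiffForm (s := s) n k = 0 := by
  ext X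
  have := X.2 k hk
  simp [zDiffForm, this.1, this.2]

lemma wDiffForm_eq_zero (n : Fin N) {k : Fin M} (hk : (k : ℕ) < s) :
    wDiffForm (s := s) n k = 0 := by
  ext X
  have := X.2 k hk
  simp [wDiffForm, this.1, this.2]

/-- The index set of the entries of one column of `(w, v - w)` that are not forced to vanish. -/
abbrev HalfIndex (M s : ℕ) : Type := Fin M ⊕ {k : Fin M // s ≤ k}

/-- The independent coordinates of the `n`-th columns of an element of `Lam M N s`. -/
def colForm (n : Fin N) : HalfIndex M s ⊕ HalfIndex M s → Module.Dual ℂ (Lam M N s) :=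
  Sum.elim (Sum.elim (wForm n) fun k => wDiffForm n k) (Sum.elim (zForm n) fun k => zDiffForm n k)

/-- The entries of `A + i A'`. -/
def leftForm (k l : Fin M) : Module.Dual ℂ (SymSkew M × SymSkew M) where
  toFun Y := Y.1.1.1 k l + Complex.I * Y.1.1.2 k l
  map_add' X Y := by simp; ring
  map_smul' c X := by simp; ring

/-- The entries of `B + i B'`. -/
def rightForm (k l : Fin M) : Module.Dual ℂ (SymSkew M × SymSkew M) where
  toFun Y := Y.2.1.1 k l + Complex.I * Y.2.1.2 k l
  map_add' X Y := by simp; ring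
  map_smul' c X := by simp; ring

/-- Both bounds need a property of all linear functionals; by duality it is enough to know it on a
family of coordinates without common zeros. -/
lemma eq_top_of_separating {V : Type*} [AddCommGroup V] [Module ℂ V] [FiniteDimensional ℂ V]
    (S : Submodule ℂ (Module.Dual ℂ V)) (hS : ∀ v, (∀ l ∈ S, l v = 0) → v = 0) : S = ⊤ := by
  have h1 : S.dualCoannihilator = ⊥ := by
    rw [eq_bot_iff]
    exact fun v hv => hS v fun l hl => (Submodule.mem_dualCoannihilator _).1 hv l hl
  rw [← Subspace.dualCoannihilator_dualAnnihilator_eq (W := S), h1, Submodule.dualAnnihilator_bot]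

lemma eq_zero_of_add_sub {a b : ℂ} (h1 : a + Complex.I * b = 0) (h2 : a - Complex.I * b = 0) :
    a = 0 ∧ b = 0 := by
  have ha : a = 0 := by linear_combination (h1 + h2) / 2
  refine ⟨ha, ?_⟩
  rw [ha, zero_add] at h1
  exact (mul_eq_zero.1 h1).resolve_left Complex.I_ne_zero

/-- The differences with row index below s may be left out of the coordinates because they are zero
functionals. -/
lemma eq_top_of_colForm_mem (S : Submodule ℂ (Module.Dual ℂ (Lam M N s)))
    (hS : ∀ n c, colForm n c ∈ S) : S = ⊤ := by
  refine eq_top_of_separating S fun X hX => ?_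
  have hz : ∀ k n, zForm n k X = 0 := fun k n => hX _ (hS n (Sum.inr (Sum.inl k)))
  have hw : ∀ k n, wForm n k X = 0 := fun k n => hX _ (hS n (Sum.inl (Sum.inl k)))
  have hz' : ∀ k n, zDiffForm n k X = 0 := fun k n => by
    by_cases hk : s ≤ k
    · exact hX _ (hS n (Sum.inr (Sum.inr ⟨k, hk⟩)))
    · rw [zDiffForm_eq_zero n (not_le.1 hk), LinearMap.zero_apply]
  have hw' : ∀ k n, wDiffForm n k X = 0 := fun k n => by
    by_cases hk : s ≤ k
    · exact hX _ (hS n (Sum.inl (Sum.inr ⟨k, hk⟩)))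
    · rw [wDiffForm_eq_zero n (not_le.1 hk), LinearMap.zero_apply]
  have h1 := fun k n => eq_zero_of_add_sub (hz k n) (hw k n)
  have h2 := fun k n => eq_zero_of_add_sub (a := X.1.2.2.1 k n) (b := X.1.2.2.2 k n)
    (by have := hz' k n; have := hz k n; simp_all [zDiffForm, zForm])
    (by have := hw' k n; have := hw k n; simp_all [wDiffForm, wForm])
  refine Subtype.ext (Prod.ext ?_ (Prod.ext ?_ (Prod.ext ?_ ?_))) <;> ext k n
  exacts [(h1 k n).1, (h1 k n).2, (h2 k n).1, (h2 k n).2]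

lemma SymSkew.eq_zero (Y : SymSkew M) (h : ∀ k l, Y.1.1 k l + Complex.I * Y.1.2 k l = 0) :
    Y = 0 := by
  have hs : ∀ k l, Y.1.1 k l = Y.1.1 l k := fun k l => congrFun (congrFun Y.2.1 l) k
  have hs' : ∀ k l, Y.1.2 k l = - Y.1.2 l k := fun k l => congrFun (congrFun Y.2.2 l) k
  -- The transposed entry supplies the combination with the opposite sign, by symmetry of the first
  -- matrix and skew-symmetry of the second.
  have := fun k l => eq_zero_of_add_sub (h k l) (by
    have := h l k
    rw [hs l k, hs' l k] at this
    linear_combination this)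
  refine Subtype.ext (Prod.ext ?_ ?_) <;> ext k l
  exacts [(this k l).1, (this k l).2]

lemma eq_top_of_entryForm_mem (S : Submodule ℂ (Module.Dual ℂ (SymSkew M × SymSkew M)))
    (hl : ∀ k l, leftForm k l ∈ S) (hr : ∀ k l, rightForm k l ∈ S) : S = ⊤ :=
  eq_top_of_separating S fun _ hY => Prod.ext (SymSkew.eq_zero _ fun k l => hY _ (hl k l))
    (SymSkew.eq_zero _ fun k l => hY _ (hr k l))

/-- The matrix `A + i A'`. -/
def leftMatrix (Y : SymSkew M × SymSkew M) : Matrix (Fin M) (Fin M) ℂ :=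
  Matrix.of fun k l => leftForm k l Y

/-- The matrix `B + i B'`. -/
def rightMatrix (Y : SymSkew M × SymSkew M) : Matrix (Fin M) (Fin M) ℂ :=
  Matrix.of fun k l => rightForm k l Y

lemma incident_iff (X : Lam M N s) (Y : SymSkew M × SymSkew M) :
    Incident (X : Quad M N) ((Y.1 : _ × _), (Y.2 : _ × _)) ↔
      leftMatrix Y ≠ rightMatrix Y ∧ (leftMatrix Y).rank = 1 ∧ (rightMatrix Y).rank = 1 ∧
      ∀ n : Fin N, (fun k => wForm n k X) ⬝ᵥ leftMatrix Y *ᵥ (fun k => zForm n k X) =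
        (fun k => wForm n k X + wDiffForm n k X) ⬝ᵥ rightMatrix Y *ᵥ
          (fun k => zForm n k X + zDiffForm n k X) := by
  have hl : Y.1.1.1 + Complex.I • Y.1.1.2 = leftMatrix Y := rfl
  have hr : Y.2.1.1 + Complex.I • Y.2.1.2 = rightMatrix Y := rfl
  have hq : ∀ n : Fin N,
      (quadExpr Y.1.1.1 Y.1.1.2 (fun i => X.1.1 i n) (fun i => X.1.2.1 i n) =
      quadExpr Y.2.1.1 Y.2.1.2 (fun i => X.1.2.2.1 i n) (fun i => X.1.2.2.2 i n)) ↔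
      (fun k => wForm n k X) ⬝ᵥ leftMatrix Y *ᵥ (fun k => zForm n k X) =
        (fun k => wForm n k X + wDiffForm n k X) ⬝ᵥ rightMatrix Y *ᵥ
          (fun k => zForm n k X + zDiffForm n k X) := by
    intro n
    rw [quadExpr_eq Y.1.2.1 Y.1.2.2, quadExpr_eq Y.2.2.1 Y.2.2.2, hl, hr]
    have e1 : (fun i => X.1.2.2.1 i n) - Complex.I • (fun i => X.1.2.2.2 i n) =
      (fun k => wForm n k X + wDiffForm n k X) := by
      funext k; simp [wForm, wDiffForm]
    have e2 : (fun i => X.1.2.2.1 i n) + Complex.I • (fun i => X.1.2.2.2 i n) =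
      (fun k => zForm n k X + zDiffForm n k X) := by
      funext k; simp [zForm, zDiffForm]
    rw [e1, e2]
    rfl
  constructor
  · rintro ⟨h1, h2, h3, h4⟩
    exact ⟨h1, h2, h3, fun n => (hq n).1 (h4 n)⟩
  · rintro ⟨h1, h2, h3, h4⟩
    exact ⟨h1, h2, h3, fun n => (hq n).2 (h4 n)⟩

lemma bilin_smul {R : Type*} [CommRing R] (a b : R) (w z : Fin M → R)
    (Q : Matrix (Fin M) (Fin M) R) :
    (a • w) ⬝ᵥ (b • Q) *ᵥ (a • z) = a ^ 2 * b * (w ⬝ᵥ Q *ᵥ z) := by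
  simp only [Matrix.smul_mulVec, Matrix.mulVec_smul, smul_dotProduct, dotProduct_smul, smul_eq_mul]
  ring

lemma leftMatrix_smul (b : ℂ) (Y : SymSkew M × SymSkew M) :
    leftMatrix (b • Y) = b • leftMatrix Y := by
  ext; simp [leftMatrix]

lemma rightMatrix_smul (b : ℂ) (Y : SymSkew M × SymSkew M) :
    rightMatrix (b • Y) = b • rightMatrix Y := by
  ext; simp [rightMatrix]

lemma bilin_eq_smul {X : Lam M N s} {Y : SymSkew M × SymSkew M} (a b : ℂ) (n : Fin N)
    (h : (fun k => wForm n k X) ⬝ᵥ leftMatrix Y *ᵥ (fun k => zForm n k X) =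
        (fun k => wForm n k X + wDiffForm n k X) ⬝ᵥ rightMatrix Y *ᵥ
          (fun k => zForm n k X + zDiffForm n k X)) :
    (fun k => wForm n k (a • X)) ⬝ᵥ leftMatrix (b • Y) *ᵥ (fun k => zForm n k (a • X)) =
        (fun k => wForm n k (a • X) + wDiffForm n k (a • X)) ⬝ᵥ rightMatrix (b • Y) *ᵥ
          (fun k => zForm n k (a • X) + zDiffForm n k (a • X)) := by
  simp only [map_smul, ← smul_add, leftMatrix_smul, rightMatrix_smul]
  exact ((bilin_smul a b _ _ _).trans (congrArg _ h)).trans (bilin_smul a b _ _ _).symm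

lemma rank_smul {b : ℂ} (hb : b ≠ 0) (Q : Matrix (Fin M) (Fin M) ℂ) : (b • Q).rank = Q.rank :=
  Matrix.rank_smul_of_mem_nonZeroDivisors Q (mem_nonZeroDivisors_of_ne_zero hb)

lemma mk_mem_incidenceVariety {X : Lam M N s} {Y : SymSkew M × SymSkew M} (hX : X ≠ 0) (hY : Y ≠ 0)
    (h : Incident (X : Quad M N) ((Y.1 : _ × _), (Y.2 : _ × _))) :
    (Projectivization.mk ℂ X hX, Projectivization.mk ℂ Y hY) ∈ incidenceVariety M N s := by
  obtain ⟨a, ha, h1⟩ := exists_rep_eq X hX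
  obtain ⟨b, hb, h2⟩ := exists_rep_eq Y hY
  change Incident ((Projectivization.mk ℂ X hX).rep : Quad M N)
    (((Projectivization.mk ℂ Y hY).rep.1 : _ × _), ((Projectivization.mk ℂ Y hY).rep.2 : _ × _))
  rw [incident_iff] at h ⊢
  rw [h1, h2]
  refine ⟨?_, ?_, ?_, fun n => bilin_eq_smul a b n (h.2.2.2 n)⟩
  · rw [leftMatrix_smul, rightMatrix_smul]
    exact fun he => h.1 (smul_right_injective _ hb he)
  · rw [leftMatrix_smul, rank_smul hb]; exact h.2.1
  · rw [rightMatrix_smul, rank_smul hb]; exact h.2.2.1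

end Coordinates

/-! ### Counting generators of the coordinate field -/

lemma card_le_of_adjoin_eq_top {F K : Type*} [Field F] [Field K] [Algebra F K] {S : Finset K}
    (hS : IntermediateField.adjoin F (S : Set K) = ⊤) {n : ℕ} {x : Fin n → K}
    (hx : AlgebraicIndependent F x) : n ≤ S.card := by
  -- Field elements are quotients of elements of the subalgebra generated by S, hence algebraic over
  -- it, so S bounds the transcendence degree.
  have halg : Algebra.IsAlgebraic (Algebra.adjoin F (S : Set K)) K := by
    refine ⟨fun y => ?_⟩
    have hy : y ∈ IntermediateField.adjoin F (S : Set K) := hS ▸ IntermediateField.mem_top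
    obtain ⟨r, hr, t, ht, rfl⟩ := IntermediateField.mem_adjoin_iff_div.1 hy
    rw [div_eq_mul_inv]
    exact (isAlgebraic_algebraMap (⟨r, hr⟩ : Algebra.adjoin F (S : Set K))).mul
      (isAlgebraic_algebraMap (⟨t, ht⟩ : Algebra.adjoin F (S : Set K))).inv
  have h1 := Algebra.IsAlgebraic.trdeg_le_cardinalMk F (S : Set K)
  have h2 := hx.lift_cardinalMk_le_trdeg
  simp only [Cardinal.mk_fin, Cardinal.lift_natCast] at h2
  have h3 := h2.trans (Cardinal.lift_le.2 h1)
  simpa using h3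

section Field

variable {F K : Type*} [Field F] [Field K] [Algebra F K] {M s : ℕ}

/-- Vanishing 2 × 2 minors express every entry through the row and column of a nonzero pivot. The
pivot is shared by both, which gives 2M - 1 generators. -/
lemma entry_mem_of_row_of_col (L : IntermediateField F K) {Q : Matrix (Fin M) (Fin M) K}
    (hQ : ∀ k l k' l', Q k l * Q k' l' = Q k l' * Q k' l) {i j : Fin M} (hij : Q i j ≠ 0)
    (hcol : ∀ k, Q k j ∈ L) (hrow : ∀ l, l ≠ j → Q i l ∈ L) (k l : Fin M) : Q k l ∈ L := by
  have h : Q k l = Q k j * Q i l / Q i j := by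
    rw [eq_div_iff hij, hQ k l i j]
  have hil : Q i l ∈ L := by
    by_cases hl : l = j
    · exact hl ▸ hcol i
    · exact hrow l hl
  rw [h]
  exact div_mem (mul_mem (hcol k) hil) (hcol i)

/-- If all but one of the terms of a vanishing linear combination lie in a subfield, then so does
the unknown in the remaining one. -/
lemma mem_of_dotProduct_mem (L : IntermediateField F K) {a w : Fin M → K} {i : Fin M}
    (hai : a i ≠ 0) (ha : ∀ k, a k ∈ L) (hw : ∀ k, k ≠ i → w k ∈ L) (h : w ⬝ᵥ a ∈ L) :
    w i ∈ L := by
  have hsum : w i * a i = w ⬝ᵥ a - ∑ k ∈ Finset.univ.erase i, w k * a k := by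
    rw [dotProduct, ← Finset.add_sum_erase _ _ (Finset.mem_univ i), add_sub_cancel_right]
  rw [← mul_div_cancel_right₀ (w i) hai, hsum]
  refine div_mem (sub_mem h (sum_mem fun k hk => ?_)) (ha i)
  exact mul_mem (hw k (Finset.ne_of_mem_erase hk)) (ha k)

lemma dotProduct_mem (L : IntermediateField F K) {a w : Fin M → K} (ha : ∀ k, a k ∈ L)
    (hw : ∀ k, w k ∈ L) : w ⬝ᵥ a ∈ L :=
  sum_mem fun k _ => mul_mem (hw k) (ha k)

/-- One coordinate of a column is redundant. -/
lemma exists_redundant_coordinate {Q R : Matrix (Fin M) (Fin M) K} (hQR : Q ≠ R)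
    {w z δ ε : Fin M → K} (hδ : ∀ k : Fin M, (k : ℕ) < s → δ k = 0)
    (hε : ∀ k : Fin M, (k : ℕ) < s → ε k = 0)
    (heq : w ⬝ᵥ Q *ᵥ z = (w + δ) ⬝ᵥ R *ᵥ (z + ε)) :
    ∃ c : HalfIndex M s ⊕ HalfIndex M s, ∀ L : IntermediateField F K,
      (∀ k l, Q k l ∈ L) → (∀ k l, R k l ∈ L) →
      (∀ c', c' ≠ c → (Sum.elim (Sum.elim w fun k => δ k) (Sum.elim z fun k => ε k) :
        HalfIndex M s ⊕ HalfIndex M s → K) c' ∈ L) →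
      (Sum.elim (Sum.elim w fun k => δ k) (Sum.elim z fun k => ε k) :
        HalfIndex M s ⊕ HalfIndex M s → K) c ∈ L := by
  obtain ⟨i, j, hij⟩ : ∃ i j, Q i j ≠ R i j := by
    by_contra! h
    exact hQR (by ext i j; exact h i j)
  have hext : ∀ (L : IntermediateField F K) (y : Fin M → K),
      (∀ k : Fin M, (k : ℕ) < s → y k = 0) → (∀ k : {k : Fin M // s ≤ k}, y k ∈ L) →
      ∀ k, y k ∈ L := by
    intro L y h0 h1 k
    by_cases hk : s ≤ k
    · exact h1 ⟨k, hk⟩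
    · rw [h0 k (not_le.1 hk)]; exact zero_mem L
  have heq' : w ⬝ᵥ (Q *ᵥ z - R *ᵥ (z + ε)) = δ ⬝ᵥ R *ᵥ (z + ε) := by
    rw [dotProduct_sub, heq, add_dotProduct]; ring
  -- This entry is the coefficient of w i in the equation. If it is nonzero, solve for w i. If it is
  -- zero, its vanishing is itself a linear equation in z, in which z j has the nonzero coefficient
  -- Q i j - R i j.
  by_cases hα : (Q *ᵥ z - R *ᵥ (z + ε)) i = 0
  · refine ⟨Sum.inr (Sum.inl j), fun L hQ hR hL => ?_⟩
    have hz : ∀ k, k ≠ j → z k ∈ L := fun k hk => hL (Sum.inr (Sum.inl k)) (by simpa using hk)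
    have hεL := hext L ε hε fun k => hL (Sum.inr (Sum.inr k)) (by simp)
    refine mem_of_dotProduct_mem L (a := fun l => Q i l - R i l) (sub_ne_zero.2 hij)
      (fun l => sub_mem (hQ i l) (hR i l)) hz ?_
    have : z ⬝ᵥ (fun l => Q i l - R i l) = ε ⬝ᵥ (fun l => R i l) := by
      have h1 : (fun l => Q i l - R i l) ⬝ᵥ z = (fun l => R i l) ⬝ᵥ ε := by
        have h2 : Q i ⬝ᵥ z - R i ⬝ᵥ (z + ε) = 0 := hα
        rw [dotProduct_add] at h2
        change (Q i - R i) ⬝ᵥ z = R i ⬝ᵥ ε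
        rw [sub_dotProduct]
        linear_combination h2
      rw [dotProduct_comm, h1, dotProduct_comm]
    rw [this]
    exact dotProduct_mem L (hR i) hεL
  · refine ⟨Sum.inl (Sum.inl i), fun L hQ hR hL => ?_⟩
    have hw : ∀ k, k ≠ i → w k ∈ L := fun k hk => hL (Sum.inl (Sum.inl k)) (by simpa using hk)
    have hz : ∀ k, z k ∈ L := fun k => hL (Sum.inr (Sum.inl k)) (by simp)
    have hεL := hext L ε hε fun k => hL (Sum.inr (Sum.inr k)) (by simp)
    have hδL := hext L δ hδ fun k => hL (Sum.inl (Sum.inr k)) (by simp)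
    have hRz : ∀ k, (R *ᵥ (z + ε)) k ∈ L := fun k => by
      rw [Matrix.mulVec, dotProduct_comm]
      exact dotProduct_mem L (hR k) fun l => add_mem (hz l) (hεL l)
    have hQz : ∀ k, (Q *ᵥ z) k ∈ L := fun k => by
      rw [Matrix.mulVec, dotProduct_comm]
      exact dotProduct_mem L (hQ k) hz
    refine mem_of_dotProduct_mem L hα (fun k => sub_mem (hQz k) (hRz k)) hw ?_
    rw [heq']
    exact dotProduct_mem L hRz hδL

/-- Two more than the dimension of the incidence variety. -/
def numParams (M N s : ℕ) : ℕ :=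
  2 * (M + (M - 1)) + N * (2 * (M + (M - s)) - 1)

lemma card_halfIndex (M s : ℕ) : Fintype.card (HalfIndex M s ⊕ HalfIndex M s) = 2 * (M + (M - s)) := by
  have : Fintype.card {k : Fin M // s ≤ k} = M - s := by
    have h1 := Fintype.card_subtype_compl (fun k : Fin M => (k : ℕ) < s)
    simp only [not_lt, Fintype.card_fin] at h1
    rw [h1, Fintype.card_subtype, Fin.card_filter_val_lt]
    omega
  simp [this]; ring

/-- The coordinates of a point of the incidence variety generate a field that is generated by
`numParams M N s` elements. -/
lemma exists_generators {N : ℕ} {Q R : Matrix (Fin M) (Fin M) K} (hQR : Q ≠ R) (hQ0 : Q ≠ 0)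
    (hR0 : R ≠ 0) (hQ : ∀ k l k' l', Q k l * Q k' l' = Q k l' * Q k' l)
    (hR : ∀ k l k' l', R k l * R k' l' = R k l' * R k' l)
    {w z δ ε : Fin N → Fin M → K} (hδ : ∀ n, ∀ k : Fin M, (k : ℕ) < s → δ n k = 0)
    (hε : ∀ n, ∀ k : Fin M, (k : ℕ) < s → ε n k = 0)
    (heq : ∀ n, w n ⬝ᵥ Q *ᵥ z n = (w n + δ n) ⬝ᵥ R *ᵥ (z n + ε n)) :
    ∃ S : Finset K, S.card ≤ numParams M N s ∧
      (∀ k l, Q k l ∈ IntermediateField.adjoin F (S : Set K)) ∧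
      (∀ k l, R k l ∈ IntermediateField.adjoin F (S : Set K)) ∧
      ∀ n c, (Sum.elim (Sum.elim (w n) fun k => δ n k) (Sum.elim (z n) fun k => ε n k) :
        HalfIndex M s ⊕ HalfIndex M s → K) c ∈ IntermediateField.adjoin F (S : Set K) := by
  classical
  have hpart : ∀ Q : Matrix (Fin M) (Fin M) K, Q ≠ 0 →
      (∀ k l k' l', Q k l * Q k' l' = Q k l' * Q k' l) → ∃ S : Finset K, S.card ≤ M + (M - 1) ∧
      ∀ L : IntermediateField F K, (∀ y ∈ S, y ∈ L) → ∀ k l, Q k l ∈ L := by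
    intro Q h0 hQ
    obtain ⟨i, j, hij⟩ : ∃ i j, Q i j ≠ 0 := by
      by_contra! h
      exact h0 (by ext i j; exact h i j)
    refine ⟨Finset.univ.image (fun k => Q k j) ∪ (Finset.univ.erase j).image (fun l => Q i l),
      ?_, fun L hL => entry_mem_of_row_of_col L hQ hij (fun k => hL _ ?_) (fun l hl => hL _ ?_)⟩
    · refine (Finset.card_union_le _ _).trans (add_le_add ?_ ?_)
      · exact Finset.card_image_le.trans (by simp)
      · exact Finset.card_image_le.trans (by simp)
    · simp
    · simp only [Finset.mem_union, Finset.mem_image]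
      exact Or.inr ⟨l, by simp [hl], rfl⟩
  obtain ⟨SQ, hSQ, hLQ⟩ := hpart Q hQ0 hQ
  obtain ⟨SR, hSR, hLR⟩ := hpart R hR0 hR
  choose c hc using fun n => exists_redundant_coordinate (F := F) hQR (hδ n) (hε n) (heq n)
  set col : Fin N → HalfIndex M s ⊕ HalfIndex M s → K := fun n =>
    Sum.elim (Sum.elim (w n) fun k => δ n k) (Sum.elim (z n) fun k => ε n k) with hcol
  let SV : Finset K := Finset.univ.biUnion fun n => (Finset.univ.erase (c n)).image (col n)
  have hSV : SV.card ≤ N * (2 * (M + (M - s)) - 1) := by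
    have := Finset.card_biUnion_le_card_mul (Finset.univ : Finset (Fin N))
      (fun n => (Finset.univ.erase (c n)).image (col n)) (2 * (M + (M - s)) - 1) fun n _ => by
        refine Finset.card_image_le.trans ?_
        rw [Finset.card_erase_of_mem (Finset.mem_univ _), Finset.card_univ, card_halfIndex]
    simpa using this
  refine ⟨SQ ∪ SR ∪ SV, ?_, ?_⟩
  · have h1 := Finset.card_union_le (SQ ∪ SR) SV
    have h2 := Finset.card_union_le SQ SR
    unfold numParams
    omega
  · set L := IntermediateField.adjoin F ((SQ ∪ SR ∪ SV : Finset K) : Set K)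
    have hL : ∀ y ∈ SQ ∪ SR ∪ SV, y ∈ L := fun y hy => IntermediateField.subset_adjoin F _ hy
    have h1 := hLQ L fun y hy => hL y (by simp [hy])
    have h2 := hLR L fun y hy => hL y (by simp [hy])
    refine ⟨h1, h2, fun n => ?_⟩
    have h3 : ∀ c', c' ≠ c n → col n c' ∈ L := fun c' hc' => hL _ (by
      refine Finset.mem_union_right _ (Finset.mem_biUnion.2 ⟨n, Finset.mem_univ _, ?_⟩)
      exact Finset.mem_image_of_mem _ (by simp [hc']))
    intro c'
    by_cases hc' : c' = c n
    · rw [hc']; exact hc n L h1 h2 h3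
    · exact h3 c' hc'

end Field

/-! ### The function field of a bicone -/

section FunctionField

variable {V W : Type*} [AddCommGroup V] [Module ℂ V] [AddCommGroup W] [Module ℂ W]
  {Z : Set (ℙ ℂ V × ℙ ℂ W)}

lemma mem_vanishingIdeal_of_evalPair {f : BiPoly V W}
    (h : ∀ p ∈ Z, ∀ a b : ℂ, evalPair (a • p.1.rep) (b • p.2.rep) f = 0) :
    f ∈ vanishingIdeal Z := fun p hp => MvPolynomial.funext fun c => by
  rw [eval_restrictPlane, map_zero]; exact h p hp _ _

/-- The homomorphism to the function field of the bicone over `Z`. -/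
def toFunctionField (Z : Set (ℙ ℂ V × ℙ ℂ W)) :
    BiPoly V W →ₐ[ℂ] FractionRing (BiPoly V W ⧸ vanishingIdeal Z) :=
  (IsScalarTower.toAlgHom ℂ (BiPoly V W ⧸ vanishingIdeal Z) _).comp (Ideal.Quotient.mkₐ ℂ _)

lemma toFunctionField_eq_zero_iff {f : BiPoly V W} :
    toFunctionField Z f = 0 ↔ f ∈ vanishingIdeal Z := by
  rw [← Ideal.Quotient.eq_zero_iff_mem]
  exact map_eq_zero_iff (algebraMap (BiPoly V W ⧸ vanishingIdeal Z) _)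
    (IsFractionRing.injective _ _)

lemma card_le_of_generators [hZ : (vanishingIdeal Z).IsPrime]
    {S : Finset (FractionRing (BiPoly V W ⧸ vanishingIdeal Z))}
    (hS : ∀ i, toFunctionField Z (X i) ∈ IntermediateField.adjoin ℂ
      (S : Set (FractionRing (BiPoly V W ⧸ vanishingIdeal Z))))
    {n : ℕ} {x : Fin n → BiPoly V W ⧸ vanishingIdeal Z} (hx : AlgebraicIndependent ℂ x) :
    n ≤ S.card := by
  have hmem : ∀ f, toFunctionField Z f ∈ IntermediateField.adjoin ℂ
      (S : Set (FractionRing (BiPoly V W ⧸ vanishingIdeal Z))) := by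
    intro f
    induction f using MvPolynomial.induction_on with
    | C a => rw [algHom_C]; exact IntermediateField.algebraMap_mem _ a
    | add p q hp hq => rw [map_add]; exact add_mem hp hq
    | mul_X p i hp => rw [map_mul]; exact mul_mem hp (hS i)
  have htop : IntermediateField.adjoin ℂ
      (S : Set (FractionRing (BiPoly V W ⧸ vanishingIdeal Z))) = ⊤ := by
    refine eq_top_iff.2 fun y _ => ?_
    obtain ⟨a, b, -, rfl⟩ := IsFractionRing.div_surjective (A := BiPoly V W ⧸ vanishingIdeal Z) y
    obtain ⟨f, rfl⟩ := Ideal.Quotient.mk_surjective a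
    obtain ⟨g, rfl⟩ := Ideal.Quotient.mk_surjective b
    exact div_mem (hmem f) (hmem g)
  exact card_le_of_adjoin_eq_top htop
    (hx.map' (f := IsScalarTower.toAlgHom ℂ (BiPoly V W ⧸ vanishingIdeal Z) _)
      (IsFractionRing.injective _ _))

variable {K : Type*} [Field K] [Algebra ℂ K] {q : BiPoly V W →ₐ[ℂ] K}

lemma map_eq_zero_of_evalPair (hq : ∀ f, q f = 0 ↔ f ∈ vanishingIdeal Z) {f : BiPoly V W}
    (h : ∀ p ∈ Z, ∀ a b : ℂ, evalPair (a • p.1.rep) (b • p.2.rep) f = 0) : q f = 0 :=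
  (hq f).2 (mem_vanishingIdeal_of_evalPair h)

/-- The functionals on the first factor whose image in the function field lies in `L`. -/
def inlSubmodule (hq : ∀ f, q f = 0 ↔ f ∈ vanishingIdeal Z) (L : IntermediateField ℂ K) :
    Submodule ℂ (Module.Dual ℂ V) where
  carrier := {l | q (X (Sum.inl l)) ∈ L}
  add_mem' {l l'} hl hl' := by
    -- Every functional is a separate variable of `BiPoly`, so linear relations between functionals
    -- hold only modulo the vanishing ideal.
    have : q (X (Sum.inl (l + l')) - (X (Sum.inl l) + X (Sum.inl l'))) = 0 :=
      map_eq_zero_of_evalPair hq fun p hp a b => by simp [mul_add]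
    rw [map_sub, map_add, sub_eq_zero] at this
    change q _ ∈ L
    rw [this]
    exact L.add_mem hl hl'
  zero_mem' := by
    have : q (X (Sum.inl 0)) = 0 := map_eq_zero_of_evalPair hq fun p hp a b => by simp
    change q _ ∈ L
    rw [this]
    exact L.zero_mem
  smul_mem' c l hl := by
    have : q (X (Sum.inl (c • l)) - c • X (Sum.inl l)) = 0 :=
      map_eq_zero_of_evalPair hq fun p hp a b => by simp; ring
    rw [map_sub, map_smul, sub_eq_zero] at this
    change q _ ∈ L
    rw [this]
    exact L.smul_mem hl

/-- The functionals on the second factor whose image in the function field lies in `L`. -/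
def inrSubmodule (hq : ∀ f, q f = 0 ↔ f ∈ vanishingIdeal Z) (L : IntermediateField ℂ K) :
    Submodule ℂ (Module.Dual ℂ W) where
  carrier := {l | q (X (Sum.inr l)) ∈ L}
  add_mem' {l l'} hl hl' := by
    have : q (X (Sum.inr (l + l')) - (X (Sum.inr l) + X (Sum.inr l'))) = 0 :=
      map_eq_zero_of_evalPair hq fun p hp a b => by simp [mul_add]
    rw [map_sub, map_add, sub_eq_zero] at this
    change q _ ∈ L
    rw [this]
    exact L.add_mem hl hl'
  zero_mem' := by
    have : q (X (Sum.inr 0)) = 0 := map_eq_zero_of_evalPair hq fun p hp a b => by simp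
    change q _ ∈ L
    rw [this]
    exact L.zero_mem
  smul_mem' c l hl := by
    have : q (X (Sum.inr (c • l)) - c • X (Sum.inr l)) = 0 :=
      map_eq_zero_of_evalPair hq fun p hp a b => by simp; ring
    rw [map_sub, map_smul, sub_eq_zero] at this
    change q _ ∈ L
    rw [this]
    exact L.smul_mem hl

lemma map_inr_ne_zero (hq : ∀ f, q f = 0 ↔ f ∈ vanishingIdeal Z) {l : Module.Dual ℂ W}
    {p : ℙ ℂ V × ℙ ℂ W} (hp : p ∈ Z) (hl : l p.2.rep ≠ 0) : q (X (Sum.inr l)) ≠ 0 := by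
  intro h
  rw [hq, mem_vanishingIdeal_iff_of_isWeightedHomogeneous
    (isWeightedHomogeneous_X ℂ (biweight V W) (Sum.inr l))] at h
  exact hl (by simpa using h p hp)

end FunctionField

/-! ### The upper bound -/

section UpperBound

attribute [local instance] zariskiTopology

variable {M N s : ℕ}

lemma minors_of_rank_eq_one {Q : Matrix (Fin M) (Fin M) ℂ} (h : Q.rank = 1) (k l k' l' : Fin M) :
    Q k l * Q k' l' = Q k l' * Q k' l := by
  obtain ⟨-, a, b, rfl⟩ := (rank_eq_one_iff Q).1 h
  simp only [Matrix.vecMulVec_apply]; ring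

lemma ne_zero_of_rank_eq_one {Q : Matrix (Fin M) (Fin M) ℂ} (h : Q.rank = 1) :
    ∃ k l, Q k l ≠ 0 := by
  by_contra! h0
  exact ((rank_eq_one_iff Q).1 h).1 (by ext k l; exact h0 k l)

/-- The function field of the bicone over a subset of the incidence variety is generated by
`numParams M N s` elements. -/
theorem exists_functionField_generators
    {Z : Set (ℙ ℂ (Lam M N s) × ℙ ℂ (SymSkew M × SymSkew M))}
    (hZ : Z ⊆ incidenceVariety M N s) (hne : Z.Nonempty) {K : Type*} [Field K] [Algebra ℂ K]
    {q : BiPoly (Lam M N s) (SymSkew M × SymSkew M) →ₐ[ℂ] K}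
    (hq : ∀ f, q f = 0 ↔ f ∈ vanishingIdeal Z) :
    ∃ S : Finset K, S.card ≤ numParams M N s ∧
      ∀ i, q (X i) ∈ IntermediateField.adjoin ℂ (S : Set K) := by
  have hZ' := fun p hp => (incident_iff _ _).1 (hZ (a := p) hp)
  obtain ⟨p₀, hp₀⟩ := hne
  have h0 := hZ' p₀ hp₀
  let Q : Matrix (Fin M) (Fin M) K := Matrix.of fun k l => q (X (Sum.inr (leftForm k l)))
  let R : Matrix (Fin M) (Fin M) K := Matrix.of fun k l => q (X (Sum.inr (rightForm k l)))
  let w := fun (n : Fin N) (k : Fin M) => q (X (Sum.inl (wForm n k)))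
  let z := fun (n : Fin N) (k : Fin M) => q (X (Sum.inl (zForm n k)))
  let δ := fun (n : Fin N) (k : Fin M) => q (X (Sum.inl (wDiffForm n k)))
  let ε := fun (n : Fin N) (k : Fin M) => q (X (Sum.inl (zDiffForm n k)))
  -- The inequations pass to the function field from the single point p₀: a linear form that is
  -- nonzero there is not in the vanishing ideal.
  have hQ0 : Q ≠ 0 := by
    obtain ⟨k, l, hkl⟩ := ne_zero_of_rank_eq_one h0.2.1
    exact fun h => map_inr_ne_zero hq hp₀ hkl (congrFun (congrFun h k) l)
  have hR0 : R ≠ 0 := by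
    obtain ⟨k, l, hkl⟩ := ne_zero_of_rank_eq_one h0.2.2.1
    exact fun h => map_inr_ne_zero hq hp₀ hkl (congrFun (congrFun h k) l)
  have hQR : Q ≠ R := by
    intro h
    obtain ⟨k, l, hkl⟩ : ∃ k l, leftMatrix p₀.2.rep k l ≠ rightMatrix p₀.2.rep k l := by
      by_contra! hc
      exact h0.1 (by ext k l; exact hc k l)
    have h1 : q (X (Sum.inr (leftForm k l)) - X (Sum.inr (rightForm k l))) = 0 := by
      rw [map_sub, sub_eq_zero]; exact congrFun (congrFun h k) l
    have h2 := (hq _).1 h1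
    rw [mem_vanishingIdeal_iff_of_isWeightedHomogeneous
      ((isWeightedHomogeneous_X ℂ (biweight _ _) (Sum.inr (leftForm k l))).sub
        (isWeightedHomogeneous_X ℂ (biweight _ _) (Sum.inr (rightForm k l))))] at h2
    have h3 := h2 p₀ hp₀
    rw [map_sub, evalPair_inr, evalPair_inr, sub_eq_zero] at h3
    exact hkl h3
  -- The equations pass to the function field because they hold at every point of Z and are
  -- bihomogeneous, hence hold on the whole bicone.
  have hQm : ∀ k l k' l', Q k l * Q k' l' = Q k l' * Q k' l := by
    intro k l k' l'
    rw [← sub_eq_zero]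
    simp only [Q, Matrix.of_apply, ← map_mul, ← map_sub]
    refine map_eq_zero_of_evalPair hq fun p hp a b => ?_
    have := minors_of_rank_eq_one (hZ' p hp).2.1 k l k' l'
    simp only [leftMatrix, Matrix.of_apply] at this
    simp only [map_sub, map_mul, evalPair_inr, map_smul, smul_eq_mul]
    linear_combination b ^ 2 * this
  have hRm : ∀ k l k' l', R k l * R k' l' = R k l' * R k' l := by
    intro k l k' l'
    rw [← sub_eq_zero]
    simp only [R, Matrix.of_apply, ← map_mul, ← map_sub]
    refine map_eq_zero_of_evalPair hq fun p hp a b => ?_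
    have := minors_of_rank_eq_one (hZ' p hp).2.2.1 k l k' l'
    simp only [rightMatrix, Matrix.of_apply] at this
    simp only [map_sub, map_mul, evalPair_inr, map_smul, smul_eq_mul]
    linear_combination b ^ 2 * this
  have hδ : ∀ n, ∀ k : Fin M, (k : ℕ) < s → δ n k = 0 := fun n k hk => by
    simp only [δ, wDiffForm_eq_zero n hk]
    exact map_eq_zero_of_evalPair hq fun p hp a b => by simp
  have hε : ∀ n, ∀ k : Fin M, (k : ℕ) < s → ε n k = 0 := fun n k hk => by
    simp only [ε, zDiffForm_eq_zero n hk]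
    exact map_eq_zero_of_evalPair hq fun p hp a b => by simp
  have heq : ∀ n, w n ⬝ᵥ Q *ᵥ z n = (w n + δ n) ⬝ᵥ R *ᵥ (z n + ε n) := by
    intro n
    rw [← sub_eq_zero]
    simp only [w, z, δ, ε, Q, R, dotProduct, Matrix.mulVec, Pi.add_apply, Matrix.of_apply,
      ← map_mul, ← map_sub, ← map_add, ← map_sum]
    refine map_eq_zero_of_evalPair hq fun p hp a b => ?_
    have := bilin_eq_smul a b n ((hZ' p hp).2.2.2 n)
    simp only [dotProduct, Matrix.mulVec, leftMatrix, rightMatrix, Matrix.of_apply] at this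
    simp only [map_sub, map_mul, map_add, map_sum, evalPair_inr, evalPair_inl]
    exact sub_eq_zero.2 this
  obtain ⟨S, hS, hSQ, hSR, hScol⟩ :=
    exists_generators (F := ℂ) hQR hQ0 hR0 hQm hRm hδ hε heq
  refine ⟨S, hS, ?_⟩
  set L := IntermediateField.adjoin ℂ (S : Set K)
  have h1 : inlSubmodule hq L = ⊤ := eq_top_of_colForm_mem _ fun n c => by
    have := hScol n c
    rcases c with (k | k) | (k | k) <;> exact this
  have h2 : inrSubmodule hq L = ⊤ := eq_top_of_entryForm_mem _ hSQ hSR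
  rintro (l | l)
  · exact (h1 ▸ Submodule.mem_top : l ∈ inlSubmodule hq L)
  · exact (h2 ▸ Submodule.mem_top : l ∈ inrSubmodule hq L)

theorem zariskiDim_incidenceVariety_le {d : ℕ} (hd : numParams M N s = d + 2) :
    zariskiDim (incidenceVariety M N s) ≤ (d : WithBot ℕ∞) := by
  refine zariskiDim_le fun Z hZ hirr n x hx => ?_
  have := vanishingIdeal_isPrime hirr
  obtain ⟨S, hS, hgen⟩ := exists_functionField_generators hZ hirr.nonempty
    (q := toFunctionField Z) fun f => toFunctionField_eq_zero_iff
  exact hd ▸ (card_le_of_generators hgen hx).trans hS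

end UpperBound

/-! ### Regular functions and points with prescribed coordinates -/

section Regular

variable {ι : Type*} {h : MvPolynomial ι ℂ}

lemma sum_mem_regularFunctions {κ : Type*} [Fintype κ] {f : κ → (ι → ℂ) → ℂ}
    (hf : ∀ k, f k ∈ regularFunctions h) : (fun x => ∑ k, f k x) ∈ regularFunctions h := by
  have := sum_mem (S := regularFunctions h) (t := Finset.univ) fun k _ => hf k
  rwa [Finset.sum_fn] at this

lemma dotProduct_mem_regularFunctions {κ : Type*} [Fintype κ] {f g : (ι → ℂ) → κ → ℂ}
    (hf : ∀ k, (fun x => f x k) ∈ regularFunctions h)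
    (hg : ∀ k, (fun x => g x k) ∈ regularFunctions h) :
    (fun x => f x ⬝ᵥ g x) ∈ regularFunctions h :=
  sum_mem_regularFunctions fun k => mul_mem (hf k) (hg k)

/-- The functionals whose composition with `φ` is regular. -/
def regularDual {V : Type*} [AddCommGroup V] [Module ℂ V] (h : MvPolynomial ι ℂ)
    (φ : (ι → ℂ) → V) : Submodule ℂ (Module.Dual ℂ V) where
  carrier := {l | (fun x => l (φ x)) ∈ regularFunctions h}
  add_mem' hl hl' := (regularFunctions h).add_mem hl hl'
  zero_mem' := (regularFunctions h).zero_mem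
  smul_mem' c _ hl := (regularFunctions h).smul_mem hl c

end Regular

section Lift

variable {M N s : ℕ}

/-- The element of `Lam M N s` with prescribed coordinates. -/
def toLam (w z δ ε : Fin N → Fin M → ℂ) (hδ : ∀ n, ∀ k : Fin M, (k : ℕ) < s → δ n k = 0)
    (hε : ∀ n, ∀ k : Fin M, (k : ℕ) < s → ε n k = 0) : Lam M N s where
  val := (Matrix.of fun k n => (z n k + w n k) / 2,
    Matrix.of fun k n => (z n k - w n k) / (2 * Complex.I),
    Matrix.of fun k n => ((z n k + ε n k) + (w n k + δ n k)) / 2,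
    Matrix.of fun k n => ((z n k + ε n k) - (w n k + δ n k)) / (2 * Complex.I))
  property k hk := by constructor <;> funext n <;> simp [hδ n k hk, hε n k hk]

section

variable (w z δ ε : Fin N → Fin M → ℂ) (hδ : ∀ n, ∀ k : Fin M, (k : ℕ) < s → δ n k = 0)
  (hε : ∀ n, ∀ k : Fin M, (k : ℕ) < s → ε n k = 0) (n : Fin N) (k : Fin M)

lemma zForm_toLam : zForm n k (toLam w z δ ε hδ hε) = z n k := by
  simp [zForm, toLam]; field_simp; ring

lemma wForm_toLam : wForm n k (toLam w z δ ε hδ hε) = w n k := by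
  simp [wForm, toLam]; field_simp; ring

lemma zDiffForm_toLam : zDiffForm n k (toLam w z δ ε hδ hε) = ε n k := by
  simp [zDiffForm, toLam]; field_simp; ring

lemma wDiffForm_toLam : wDiffForm n k (toLam w z δ ε hδ hε) = δ n k := by
  simp [wDiffForm, toLam]; field_simp; ring

end

/-- The pair of a symmetric matrix `A` and a skew-symmetric matrix `A'` with `A + i A' = Q`. -/
def toSymSkew (Q : Matrix (Fin M) (Fin M) ℂ) : SymSkew M where
  val := ((2⁻¹ : ℂ) • (Q + Qᵀ), (2 * Complex.I)⁻¹ • (Q - Qᵀ))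
  property := by
    constructor
    · simp [add_comm]
    · simp [← smul_neg]

lemma toSymSkew_apply (Q : Matrix (Fin M) (Fin M) ℂ) (k l : Fin M) :
    (toSymSkew Q).1.1 k l + Complex.I * (toSymSkew Q).1.2 k l = Q k l := by
  simp [toSymSkew]; field_simp; linear_combination (Q l k - Q k l) * Complex.I_sq

lemma leftForm_toSymSkew (Q R : Matrix (Fin M) (Fin M) ℂ) (k l : Fin M) :
    leftForm k l (toSymSkew Q, toSymSkew R) = Q k l := toSymSkew_apply Q k l

lemma rightForm_toSymSkew (Q R : Matrix (Fin M) (Fin M) ℂ) (k l : Fin M) :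
    rightForm k l (toSymSkew Q, toSymSkew R) = R k l := toSymSkew_apply R k l

end Lift

/-! ### The lower bound: an explicit rational parametrization -/

section LowerBound

variable {M : ℕ} (N s : ℕ) (o : Fin M)

/-- The parameters: the `o`-th column and row of two matrices of rank one, and all coordinates of
the vectors except the `o`-th entries of `w`. -/
abbrev Param : Type :=
  ((Fin M ⊕ {l : Fin M // l ≠ o}) ⊕ (Fin M ⊕ {l : Fin M // l ≠ o})) ⊕
    (Fin N × {c : HalfIndex M s ⊕ HalfIndex M s // c ≠ Sum.inl (Sum.inl o)})

lemma card_param : Fintype.card (Param N s o) = numParams M N s := by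
  have h1 : Fintype.card {l : Fin M // l ≠ o} = M - 1 := by simp
  have h2 : Fintype.card {c : HalfIndex M s ⊕ HalfIndex M s // c ≠ Sum.inl (Sum.inl o)} =
      2 * (M + (M - s)) - 1 := by
    rw [← card_halfIndex, Fintype.card_subtype_compl, Fintype.card_subtype_eq]
  rw [Fintype.card_sum, Fintype.card_sum, Fintype.card_prod, Fintype.card_sum, h1, h2, numParams]
  simp; ring

variable {N s o}

section RankOne

variable (inc : Fin M ⊕ {l : Fin M // l ≠ o} → Param N s o)

/-- The entries of the `o`-th row. -/
def rowPoly (l : Fin M) : MvPolynomial (Param N s o) ℂ :=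
  if h : l = o then X (inc (Sum.inl o)) else X (inc (Sum.inr ⟨l, h⟩))

/-- The matrix of rank one with prescribed `o`-th column and row. -/
def rankOne (x : Param N s o → ℂ) : Matrix (Fin M) (Fin M) ℂ :=
  Matrix.vecMulVec (fun k => x (inc (Sum.inl k)))
    (fun l => eval x (rowPoly inc l) * (x (inc (Sum.inl o)))⁻¹)

variable {inc} {x : Param N s o → ℂ}

lemma rankOne_col (hx : x (inc (Sum.inl o)) ≠ 0) (k : Fin M) : rankOne inc x k o = x (inc (Sum.inl k)) := by
  simp [rankOne, Matrix.vecMulVec_apply, rowPoly, hx]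

lemma rankOne_row (hx : x (inc (Sum.inl o)) ≠ 0) (l : Fin M) : rankOne inc x o l = eval x (rowPoly inc l) := by
  simp [rankOne, Matrix.vecMulVec_apply]
  field_simp

lemma rank_rankOne (hx : x (inc (Sum.inl o)) ≠ 0) : (rankOne inc x).rank = 1 :=
  (rank_eq_one_iff _).2 ⟨fun h => hx (by rw [← rankOne_col hx o, h]; rfl), _, _, rfl⟩

end RankOne

/-- The coordinates of the vectors, with the dependent one set to zero. -/
def colPoly (n : Fin N) (c : HalfIndex M s ⊕ HalfIndex M s) : MvPolynomial (Param N s o) ℂ :=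
  if h : c = Sum.inl (Sum.inl o) then 0 else X (Sum.inr (n, ⟨c, h⟩))

/-- Extension by zero of the coordinates with row index at least `s`. -/
def extendPoly (f : {k : Fin M // s ≤ k} → MvPolynomial (Param N s o) ℂ) (k : Fin M) :
    MvPolynomial (Param N s o) ℂ :=
  if h : s ≤ k then f ⟨k, h⟩ else 0

/-- The entries of `w`, the dependent one set to zero. -/
def wParam (x : Param N s o → ℂ) (n : Fin N) (k : Fin M) : ℂ :=
  eval x (colPoly n (Sum.inl (Sum.inl k)))

/-- The entries of `z`. -/
def zPoly (n : Fin N) (k : Fin M) : MvPolynomial (Param N s o) ℂ := colPoly n (Sum.inr (Sum.inl k))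

/-- The entries of `v - w` in the left factor. -/
def wDiffPoly (n : Fin N) : Fin M → MvPolynomial (Param N s o) ℂ :=
  extendPoly fun k => colPoly n (Sum.inl (Sum.inr k))

/-- The entries of the difference in the right factor. -/
def zDiffPoly (n : Fin N) : Fin M → MvPolynomial (Param N s o) ℂ :=
  extendPoly fun k => colPoly n (Sum.inr (Sum.inr k))

/-- The position of the parameters of the first matrix. -/
abbrev incLeft (c : Fin M ⊕ {l : Fin M // l ≠ o}) : Param N s o := Sum.inl (Sum.inl c)

/-- The position of the parameters of the second matrix. -/
abbrev incRight (c : Fin M ⊕ {l : Fin M // l ≠ o}) : Param N s o := Sum.inl (Sum.inr c)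

/-- The coefficient of the dependent coordinate in the `n`-th equation. -/
def pivotPoly (n : Fin N) : MvPolynomial (Param N s o) ℂ :=
  ∑ l, (rowPoly incLeft l * zPoly n l - rowPoly incRight l * (zPoly n l + zDiffPoly n l))

/-- The vector `Q z - R (z + ε)`. -/
def pivotVec (x : Param N s o → ℂ) (n : Fin N) : Fin M → ℂ :=
  rankOne incLeft x *ᵥ (fun k => eval x (zPoly n k)) -
    rankOne incRight x *ᵥ (fun k => eval x (zPoly n k) + eval x (zDiffPoly n k))

/-- The solution `w` of the `n`-th equation. -/
def wSol (x : Param N s o → ℂ) (n : Fin N) (k : Fin M) : ℂ :=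
  if k = o then
    ((fun k => eval x (wDiffPoly n k)) ⬝ᵥ
      rankOne incRight x *ᵥ (fun k => eval x (zPoly n k) + eval x (zDiffPoly n k)) -
      wParam x n ⬝ᵥ pivotVec x n) * (eval x (pivotPoly n))⁻¹
  else wParam x n k

/-- Only the o-th rows of the two matrices enter, and their entries are parameters; hence this
coefficient is a polynomial although other entries have denominators. -/
lemma pivotVec_apply {x : Param N s o → ℂ} (hl : x (incLeft (Sum.inl o)) ≠ 0)
    (hr : x (incRight (Sum.inl o)) ≠ 0) (n : Fin N) : pivotVec x n o = eval x (pivotPoly n) := by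
  simp only [pivotVec, pivotPoly, Pi.sub_apply, Matrix.mulVec, dotProduct, rankOne_row hl,
    rankOne_row hr, map_sum, map_sub, map_mul, map_add, Finset.sum_sub_distrib]

lemma wParam_self (x : Param N s o → ℂ) (n : Fin N) : wParam x n o = 0 := by
  simp [wParam, colPoly]

/-- The equation says that w has a prescribed product r with `pivotVec`. Since w is its free part,
zero at o, plus a multiple of the o-th basis vector, that multiple is found by dividing by the o-th
entry. -/
lemma wSol_dotProduct {x : Param N s o → ℂ} (hl : x (incLeft (Sum.inl o)) ≠ 0)
    (hr : x (incRight (Sum.inl o)) ≠ 0) (n : Fin N) (hn : eval x (pivotPoly n) ≠ 0) :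
    wSol x n ⬝ᵥ rankOne incLeft x *ᵥ (fun k => eval x (zPoly n k)) =
      (fun k => wSol x n k + eval x (wDiffPoly n k)) ⬝ᵥ
        rankOne incRight x *ᵥ (fun k => eval x (zPoly n k) + eval x (zDiffPoly n k)) := by
  set r := (fun k => eval x (wDiffPoly n k)) ⬝ᵥ
    rankOne incRight x *ᵥ (fun k => eval x (zPoly n k) + eval x (zDiffPoly n k)) with hrdef
  have h1 : wSol x n = wParam x n +
      Pi.single o ((r - wParam x n ⬝ᵥ pivotVec x n) * (eval x (pivotPoly n))⁻¹) := by
    funext k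
    by_cases hk : k = o
    · subst hk
      simp [wSol, wParam_self, hrdef]
    · simp [wSol, hk]
  have h2 : wSol x n ⬝ᵥ pivotVec x n = r := by
    rw [h1, add_dotProduct, single_dotProduct, pivotVec_apply hl hr, inv_mul_cancel_right₀ hn]
    ring
  rw [pivotVec, dotProduct_sub, sub_eq_iff_eq_add] at h2
  rw [h2]
  change _ = (wSol x n + fun k => eval x (wDiffPoly n k)) ⬝ᵥ _
  rw [add_dotProduct, add_comm]

lemma eval_extendPoly (x : Param N s o → ℂ)
    (f : {k : Fin M // s ≤ k} → MvPolynomial (Param N s o) ℂ) (k : Fin M) (hk : (k : ℕ) < s) :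
    eval x (extendPoly f k) = 0 := by
  simp [extendPoly, not_le.2 hk]

/-- The vectors with given parameters. -/
def vecParam (x : Param N s o → ℂ) : Lam M N s :=
  toLam (wSol x) (fun n k => eval x (zPoly n k)) (fun n k => eval x (wDiffPoly n k))
    (fun n k => eval x (zDiffPoly n k)) (fun _ => eval_extendPoly x _)
    (fun _ => eval_extendPoly x _)

lemma wForm_vecParam (x : Param N s o → ℂ) (n : Fin N) (k : Fin M) :
    wForm n k (vecParam x) = wSol x n k := wForm_toLam _ _ _ _ _ _ n k

lemma zForm_vecParam (x : Param N s o → ℂ) (n : Fin N) (k : Fin M) :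
    zForm n k (vecParam x) = eval x (zPoly n k) := zForm_toLam _ _ _ _ _ _ n k

lemma wDiffForm_vecParam (x : Param N s o → ℂ) (n : Fin N) (k : Fin M) :
    wDiffForm n k (vecParam x) = eval x (wDiffPoly n k) := wDiffForm_toLam _ _ _ _ _ _ n k

lemma zDiffForm_vecParam (x : Param N s o → ℂ) (n : Fin N) (k : Fin M) :
    zDiffForm n k (vecParam x) = eval x (zDiffPoly n k) := zDiffForm_toLam _ _ _ _ _ _ n k

/-- The matrices with given parameters. -/
def matParam (x : Param N s o → ℂ) : SymSkew M × SymSkew M :=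
  (toSymSkew (rankOne incLeft x), toSymSkew (rankOne incRight x))

/-- The `z`-coordinate used as homogeneous reference. -/
abbrev refVec (n₀ : Fin N) : Param N s o := Sum.inr (n₀, ⟨Sum.inr (Sum.inl o), Sum.inr_ne_inl⟩)

/-- The polynomial whose nonvanishing makes the parametrization valid. -/
def denomPoly (n₀ : Fin N) : MvPolynomial (Param N s o) ℂ :=
  X (incLeft (Sum.inl o)) * X (incRight (Sum.inl o)) *
    (X (incLeft (Sum.inl o)) - X (incRight (Sum.inl o))) * X (refVec n₀) * ∏ n, pivotPoly n

lemma eval_denomPoly_ne_zero {n₀ : Fin N} {x : Param N s o → ℂ}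
    (hx : eval x (denomPoly n₀) ≠ 0) :
    x (incLeft (Sum.inl o)) ≠ 0 ∧ x (incRight (Sum.inl o)) ≠ 0 ∧
      x (incLeft (Sum.inl o)) ≠ x (incRight (Sum.inl o)) ∧ x (refVec n₀) ≠ 0 ∧
      ∀ n, eval x (pivotPoly n) ≠ 0 := by
  simpa [denomPoly, Finset.prod_ne_zero_iff, sub_eq_zero, and_assoc] using hx

lemma leftMatrix_matParam (x : Param N s o → ℂ) : leftMatrix (matParam x) = rankOne incLeft x := by
  ext k l; exact leftForm_toSymSkew _ _ k l

lemma rightMatrix_matParam (x : Param N s o → ℂ) :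
    rightMatrix (matParam x) = rankOne incRight x := by
  ext k l; exact rightForm_toSymSkew _ _ k l

lemma incident_param {n₀ : Fin N} {x : Param N s o → ℂ} (hx : eval x (denomPoly n₀) ≠ 0) :
    Incident (vecParam x : Quad M N) (((matParam x).1 : _ × _), ((matParam x).2 : _ × _)) := by
  obtain ⟨hl, hr, hlr, -, hpiv⟩ := eval_denomPoly_ne_zero hx
  rw [incident_iff, leftMatrix_matParam, rightMatrix_matParam]
  refine ⟨fun h => hlr ?_, rank_rankOne hl, rank_rankOne hr, fun n => ?_⟩
  · rw [← rankOne_col hl o, h, rankOne_col hr o]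
  · simp only [wForm_vecParam, zForm_vecParam, wDiffForm_vecParam, zDiffForm_vecParam]
    exact wSol_dotProduct hl hr n (hpiv n)

/-- The linear form that recovers a parameter. -/
def paramForm : Param N s o → Module.Dual ℂ (Lam M N s) ⊕ Module.Dual ℂ (SymSkew M × SymSkew M)
  | Sum.inl (Sum.inl (Sum.inl k)) => Sum.inr (leftForm k o)
  | Sum.inl (Sum.inl (Sum.inr l)) => Sum.inr (leftForm o l)
  | Sum.inl (Sum.inr (Sum.inl k)) => Sum.inr (rightForm k o)
  | Sum.inl (Sum.inr (Sum.inr l)) => Sum.inr (rightForm o l)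
  | Sum.inr (n, c) => Sum.inl (colForm n c)

lemma evalPair_paramForm {n₀ : Fin N} {x : Param N s o → ℂ} (hx : eval x (denomPoly n₀) ≠ 0)
    (i : Param N s o) : evalPair (vecParam x) (matParam x) (X (paramForm i)) = x i := by
  obtain ⟨hl, hr, -⟩ := eval_denomPoly_ne_zero hx
  rcases i with ((k | l) | (k | l)) | ⟨n, ⟨((k | k) | (k | k)), hc⟩⟩
  · rw [paramForm, evalPair_inr, matParam, leftForm_toSymSkew, rankOne_col hl]
  · rw [paramForm, evalPair_inr, matParam, leftForm_toSymSkew, rankOne_row hl, rowPoly,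
      dif_neg l.2, eval_X]
  · rw [paramForm, evalPair_inr, matParam, rightForm_toSymSkew, rankOne_col hr]
  · rw [paramForm, evalPair_inr, matParam, rightForm_toSymSkew, rankOne_row hr, rowPoly,
      dif_neg l.2, eval_X]
  · have hk : k ≠ o := fun h => hc (by rw [h])
    rw [paramForm, evalPair_inl, colForm, Sum.elim_inl, Sum.elim_inl, wForm_vecParam, wSol,
      if_neg hk, wParam, colPoly, dif_neg hc, eval_X]
  · rw [paramForm, evalPair_inl, colForm, Sum.elim_inl, Sum.elim_inr, wDiffForm_vecParam,
      wDiffPoly, extendPoly, dif_pos k.2, colPoly, dif_neg hc, eval_X]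
  · rw [paramForm, evalPair_inl, colForm, Sum.elim_inr, Sum.elim_inl, zForm_vecParam,
      zPoly, colPoly, dif_neg hc, eval_X]
  · rw [paramForm, evalPair_inl, colForm, Sum.elim_inr, Sum.elim_inr, zDiffForm_vecParam,
      zDiffPoly, extendPoly, dif_pos k.2, colPoly, dif_neg hc, eval_X]

section Regularity

variable (n₀ : Fin N)

lemma inv_left_mem :
    (fun x : Param N s o → ℂ => (x (incLeft (Sum.inl o)))⁻¹) ∈ regularFunctions (denomPoly n₀) := by
  have := inv_mem_regularFunctions (h := denomPoly n₀)
    (P := (X (incLeft (Sum.inl o)) : MvPolynomial (Param N s o) ℂ))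
    (by simp only [denomPoly, mul_assoc]; exact dvd_mul_right _ _)
  simpa using this

lemma inv_right_mem :
    (fun x : Param N s o → ℂ => (x (incRight (Sum.inl o)))⁻¹) ∈
      regularFunctions (denomPoly n₀) := by
  have := inv_mem_regularFunctions (h := denomPoly n₀)
    (P := (X (incRight (Sum.inl o)) : MvPolynomial (Param N s o) ℂ))
    (by simp only [denomPoly, mul_assoc]; rw [mul_left_comm]; exact dvd_mul_right _ _)
  simpa using this

lemma inv_pivot_mem (n : Fin N) :
    (fun x : Param N s o → ℂ => (eval x (pivotPoly n))⁻¹) ∈ regularFunctions (denomPoly n₀) :=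
  inv_mem_regularFunctions
    ((Finset.dvd_prod_of_mem _ (Finset.mem_univ n)).trans (dvd_mul_left _ _))

lemma coord_mem (h : MvPolynomial (Param N s o) ℂ) (i : Param N s o) :
    (fun x : Param N s o → ℂ => x i) ∈ regularFunctions h := by
  simpa using eval_mem_regularFunctions h (X i)

lemma rankOne_left_mem (k l : Fin M) : (fun x : Param N s o → ℂ => rankOne incLeft x k l) ∈
    regularFunctions (denomPoly n₀) :=
  mul_mem (coord_mem _ _) (mul_mem (eval_mem_regularFunctions _ _) (inv_left_mem n₀))

lemma rankOne_right_mem (k l : Fin M) : (fun x : Param N s o → ℂ => rankOne incRight x k l) ∈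
    regularFunctions (denomPoly n₀) :=
  mul_mem (coord_mem _ _) (mul_mem (eval_mem_regularFunctions _ _) (inv_right_mem n₀))

lemma zPoly_add_mem (n : Fin N) (k : Fin M) :
    (fun x : Param N s o → ℂ => eval x (zPoly n k) + eval x (zDiffPoly n k)) ∈
      regularFunctions (denomPoly n₀) :=
  add_mem (eval_mem_regularFunctions _ _) (eval_mem_regularFunctions _ _)

lemma rankOne_right_mulVec_mem (n : Fin N) (k : Fin M) :
    (fun x : Param N s o → ℂ =>
      (rankOne incRight x *ᵥ fun k => eval x (zPoly n k) + eval x (zDiffPoly n k)) k) ∈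
      regularFunctions (denomPoly n₀) :=
  dotProduct_mem_regularFunctions (fun l => rankOne_right_mem n₀ k l) (zPoly_add_mem n₀ n)

lemma pivotVec_mem (n : Fin N) (k : Fin M) :
    (fun x : Param N s o → ℂ => pivotVec x n k) ∈ regularFunctions (denomPoly n₀) :=
  sub_mem (dotProduct_mem_regularFunctions (fun l => rankOne_left_mem n₀ k l)
    fun _ => eval_mem_regularFunctions _ _) (rankOne_right_mulVec_mem n₀ n k)

lemma wSol_mem (n : Fin N) (k : Fin M) :
    (fun x : Param N s o → ℂ => wSol x n k) ∈ regularFunctions (denomPoly n₀) := by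
  by_cases hk : k = o
  · simp only [wSol, if_pos hk]
    refine mul_mem (sub_mem ?_ ?_) (inv_pivot_mem n₀ n)
    · exact dotProduct_mem_regularFunctions (fun _ => eval_mem_regularFunctions _ _)
        (rankOne_right_mulVec_mem n₀ n)
    · exact dotProduct_mem_regularFunctions (fun _ => eval_mem_regularFunctions _ _)
        (pivotVec_mem n₀ n)
  · simp only [wSol, if_neg hk]
    exact eval_mem_regularFunctions _ _

lemma dual_vecParam_mem (l : Module.Dual ℂ (Lam M N s)) :
    (fun x : Param N s o → ℂ => l (vecParam x)) ∈ regularFunctions (denomPoly n₀) := by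
  have : regularDual (denomPoly n₀) (vecParam : (Param N s o → ℂ) → Lam M N s) = ⊤ := by
    refine eq_top_of_colForm_mem _ fun n c => ?_
    change (fun x => colForm n c (vecParam x)) ∈ regularFunctions (denomPoly n₀)
    rcases c with (k | k) | (k | k)
    · simp only [colForm, Sum.elim_inl, wForm_vecParam]
      exact wSol_mem n₀ n k
    · simp only [colForm, Sum.elim_inl, Sum.elim_inr, wDiffForm_vecParam]
      exact eval_mem_regularFunctions _ _
    · simp only [colForm, Sum.elim_inl, Sum.elim_inr, zForm_vecParam]
      exact eval_mem_regularFunctions _ _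
    · simp only [colForm, Sum.elim_inr, zDiffForm_vecParam]
      exact eval_mem_regularFunctions _ _
  exact (this ▸ Submodule.mem_top : l ∈ regularDual (denomPoly n₀) vecParam)

lemma dual_matParam_mem (l : Module.Dual ℂ (SymSkew M × SymSkew M)) :
    (fun x : Param N s o → ℂ => l (matParam x)) ∈ regularFunctions (denomPoly n₀) := by
  have : regularDual (denomPoly n₀) (matParam : (Param N s o → ℂ) → _) = ⊤ := by
    refine eq_top_of_entryForm_mem _ (fun k l => ?_) fun k l => ?_
    · change (fun x => leftForm k l (matParam x)) ∈ regularFunctions (denomPoly n₀)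
      simp only [matParam, leftForm_toSymSkew]
      exact rankOne_left_mem n₀ k l
    · change (fun x => rightForm k l (matParam x)) ∈ regularFunctions (denomPoly n₀)
      simp only [matParam, rightForm_toSymSkew]
      exact rankOne_right_mem n₀ k l
  exact (this ▸ Submodule.mem_top : l ∈ regularDual (denomPoly n₀) matParam)

end Regularity

/-- A point at which the parametrization is valid. -/
def basePoint : Param N s o → ℂ
  | Sum.inl (Sum.inl (Sum.inl k)) => if k = o then 1 else 0
  | Sum.inl (Sum.inr (Sum.inl k)) => if k = o then 2 else 0
  | Sum.inl (Sum.inl (Sum.inr _)) => 0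
  | Sum.inl (Sum.inr (Sum.inr _)) => 0
  | Sum.inr (_, c) => if c.1 = Sum.inr (Sum.inl o) then 1 else 0

/-- At the base point the o-th rows are 1 and 2 times the o-th unit vector, z is that unit vector
and ε = 0, so the pivot is 1 - 2. -/
lemma eval_basePoint_pivotPoly (n : Fin N) :
    eval (basePoint (N := N) (s := s) (o := o)) (pivotPoly n) = -1 := by
  rw [pivotPoly, map_sum, Finset.sum_eq_single o]
  · by_cases hs : s ≤ o <;>
    simp [rowPoly, zPoly, zDiffPoly, extendPoly, colPoly, basePoint, hs] <;> norm_num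
  · intro l _ hl
    simp [rowPoly, hl, basePoint]
  · simp

lemma eval_basePoint_denomPoly (n₀ : Fin N) :
    eval (basePoint (s := s) (o := o)) (denomPoly n₀) ≠ 0 := by
  simp only [denomPoly, map_mul, map_sub, map_prod, eval_basePoint_pivotPoly, eval_X]
  simp [basePoint]
  norm_num

theorem le_zariskiDim_incidenceVariety (o : Fin M) (n₀ : Fin N) {d : ℕ}
    (hd : numParams M N s = d + 2) :
    (d : WithBot ℕ∞) ≤ zariskiDim (incidenceVariety M N s) := by
  classical
  -- Fixing one matrix parameter and one vector parameter removes the two scalings. One matrix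
  -- reference suffices since both matrices are scaled together.
  let ρ : Param N s o := incLeft (Sum.inl o)
  let ρ' : Param N s o := refVec n₀
  have hρ : ρ ≠ ρ' := Sum.inl_ne_inr
  have hcard : Fintype.card {i : Param N s o // i ∉ ({ρ, ρ'} : Finset _)} = d := by
    rw [Fintype.card_subtype_compl, card_param, hd, Fintype.card_coe, Finset.card_pair hρ]
    omega
  let e : Fin d ↪ Param N s o :=
    (Fintype.equivFinOfCardEq hcard).symm.toEmbedding.trans (Function.Embedding.subtype _)
  have he : ∀ i, i = ρ ∨ i = ρ' → i ∉ Set.range e := by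
    rintro i hi ⟨j, rfl⟩
    have := ((Fintype.equivFinOfCardEq hcard).symm j).2
    rw [Finset.mem_insert, Finset.mem_singleton] at this
    exact this hi
  have hρ1 : basePoint ρ = (1 : ℂ) := by simp [ρ, basePoint]
  have hρ1' : basePoint ρ' = (1 : ℂ) := by simp [ρ', basePoint]
  let ref : Param N s o → Param N s o := Sum.elim (fun _ => ρ) (fun _ => ρ')
  -- The condition that parameter i has its base value, homogenized by the reference form of the
  -- same bidegree.
  have href : ∀ i, ∃ m, (X (paramForm i) - MvPolynomial.C (basePoint i) * X (paramForm (ref i)) :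
      BiPoly (Lam M N s) (SymSkew M × SymSkew M)).IsWeightedHomogeneous (biweight _ _) m := by
    intro i
    refine ⟨biweight _ _ (paramForm i), (isWeightedHomogeneous_X _ _ _).sub
      (IsWeightedHomogeneous.C_mul ?_ _)⟩
    have : biweight (Lam M N s) (SymSkew M × SymSkew M) (paramForm i) =
        biweight _ _ (paramForm (ref i)) := by
      rcases i with ((k | l) | (k | l)) | c <;> rfl
    rw [this]
    exact isWeightedHomogeneous_X _ _ _
  choose m hm using href
  refine le_zariskiDim (dual_vecParam_mem n₀) (dual_matParam_mem n₀) (fun x hx => ?_)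
    (eval_basePoint_denomPoly n₀) e (fun i => hm (e i)) fun i x hx hxe => ?_
  · obtain ⟨hl, -, -, hz, -⟩ := eval_denomPoly_ne_zero hx
    have hv : vecParam x ≠ 0 := fun h => hz (by
      rw [← evalPair_paramForm hx (refVec n₀), paramForm, evalPair_inl, h, map_zero])
    have hw : matParam x ≠ 0 := fun h => hl (by
      rw [← evalPair_paramForm hx (incLeft (Sum.inl o)), paramForm, evalPair_inr, h, map_zero])
    exact ⟨hv, hw, mk_mem_incidenceVariety hv hw (incident_param hx)⟩
  -- The references are not among the varied parameters, so they keep the base value 1 and the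
  -- homogenized equation reduces to the affine one.
  · have h1 : x (ref (e i)) = 1 := by
      rcases e i with c | c
      · exact (hxe ρ (he _ (Or.inl rfl))).trans hρ1
      · exact (hxe ρ' (he _ (Or.inr rfl))).trans hρ1'
    rw [map_sub, map_mul, evalPair_paramForm hx, evalPair_paramForm hx, h1, mul_one, algHom_C,
      sub_eq_zero]
    rfl

end LowerBound

end FramePairs

end

/-- The incidence variety has dimension `4M + 4MN - N - 2sN - 4`. -/
theorem mainTheorem8 (M N s : ℕ) (hM : 1 ≤ M) (hN : 1 ≤ N) (hs : s ≤ M) :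
    ∃ d : ℕ, FramePairs.zariskiDim (FramePairs.incidenceVariety M N s) = (d : WithBot ℕ∞) ∧
      (d : ℤ) = 4 * M + 4 * M * N - N - 2 * s * N - 4 := by
  obtain ⟨t, rfl⟩ := Nat.exists_eq_add_of_le hs
  have h1 : ((FramePairs.numParams (s + t) N s : ℕ) : ℤ) =
      4 * (s + t : ℕ) + 4 * (s + t : ℕ) * N - N - 2 * s * N - 2 := by
    rw [FramePairs.numParams, Nat.add_sub_cancel_left]
    -- Both remaining truncated subtractions in `numParams` are genuine because M ≥ 1.
    push_cast [Nat.cast_sub hM, Nat.cast_sub (show 1 ≤ 2 * (s + t + t) by omega)]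
    ring
  have h2 : 2 ≤ FramePairs.numParams (s + t) N s := by
    have : 1 ≤ N * (2 * (s + t + (s + t - s)) - 1) :=
      Nat.mul_pos hN (by omega)
    unfold FramePairs.numParams
    omega
  obtain ⟨d, hd⟩ := Nat.exists_eq_add_of_le' h2
  refine ⟨d, le_antisymm (FramePairs.zariskiDim_incidenceVariety_le hd)
    (FramePairs.le_zariskiDim_incidenceVariety ⟨0, hM⟩ ⟨0, hN⟩ hd), ?_⟩
  rw [hd] at h1
  push_cast at h1 ⊢
  linarith
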